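/- **Notation.** Let $J=\begin{bmatrix}0&1_2\\-1_2&0\end{bmatrix}$ and ${\rm GSp}(4,\mathbb R)=\{g\in{\rm GL}(4,\mathbb R):{}^tgJg=\mu_2(g)J\text{ for some }\mu_2(g)\in\mathbb R^\times\}$, and let $K={\rm GSp}(4,\mathbb R)\cap{\rm O}(4)$ be its standard maximal compact subgroup. Let $U(\mathbb R)$ be the group of matrices $\begin{bmatrix}1&X\\&1\end{bmatrix}$ with $X\in M(2,\mathbb R)$ symmetric, and let $L=\{\begin{bmatrix}A&\\&c\,{}^tA^{-1}\end{bmatrix}:A\in{\rm GL}(2,\mathbb R),\ c\in\mathbb R^\times\}$. For a real symmetric $2\times2$ matrix $S$ let $\theta$ be the character $\theta(\begin{bmatrix}1&X\\&1\end{bmatrix})=e^{2\pi i\,{\rm tr}(SX)}$ of $U(\mathbb R)$, let $T(\mathbb R)=\{g\in L:\theta(u)=\theta(gug^{-1})\text{ for all }u\in U(\mathbb R)\}$, and let $T(\mathbb R)_0$ be the identity component of $T(\mathbb R)$ in the real topology. A character of $T(\mathbb R)_0$ is a continuous homomorphism $T(\mathbb R)_0\to\mathbb C^\times$ (not necessarily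 unitary). Put $\|g\|=\big(\mu_2(g)^{-2}+\sum_{i,j}g_{ij}^2\big)^{1/2}$. For $X$ in the Lie algebra $\mathfrak g^1$ of ${\rm Sp}(4,\mathbb R)$ and a smooth function $B$ on ${\rm GSp}(4,\mathbb R)$ let $(X.B)(g)=\frac{d}{dt}\big|_0B(g\exp(tX))$, extended $\mathbb C$-linearly to $X\in\mathfrak g^1_{\mathbb C}$. In $2\times2$ blocks, let $e_1={\rm diag}(1,0)$, $e_2={\rm diag}(0,1)$, $w=\begin{bmatrix}0&1\\1&0\end{bmatrix}$, $j=\begin{bmatrix}0&1\\-1&0\end{bmatrix}$ and $$Z=-i\begin{bmatrix}0&e_1\\-e_1&0\end{bmatrix},\quad Z'=-i\begin{bmatrix}0&e_2\\-e_2&0\end{bmatrix},\quad N_+=\tfrac12\begin{bmatrix}j&-iw\\iw&j\end{bmatrix},$$ $$X_-=\tfrac12\begin{bmatrix}e_1&-ie_1\\-ie_1&-e_1\end{bmatrix},\quad P_{1-}=\tfrac12\begin{bmatrix}w&-iw\\-iw&-w\end{bmatrix},\quad P_{0-}=\tfrac12\begin{bmatrix}e_2&-ie_2\\-ie_2&-e_2\end{bmatrix}.$$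 For integers $l,l'$ and a character $\Lambda$ of $T(\mathbb R)_0$ let $\mathcal S(\Lambda,\theta,l,l')$ be the space of all functions $B:{\rm GSp}(4,\mathbb R)\to\mathbb C$ such that 1. $B$ is smooth and $K$-finite (its right translates by $K$ span a finite-dimensional space); 2. $B(tug)=\Lambda(t)\theta(u)B(g)$ for all $t\in T(\mathbb R)_0$, $u\in U(\mathbb R)$, $g\in{\rm GSp}(4,\mathbb R)$; 3. $B$ is slowly increasing: there are $\alpha,\beta>0$ with $|B(g)|\le\alpha\|g\|^\beta$ for all $g\in{\rm GSp}(4,\mathbb R)$; 4. $Z.B=lB$ and $Z'.B=l'B$; 5. $N_+.B=X_-.B=P_{1-}.B=P_{0-}.B=0$. **Theorem.** Let $S$ be a real symmetric $2\times2$ matrix with $\det(S)<0$, and let $l\ge l'>0$ be integers. Then for every character $\Lambda$ of $T(\mathbb R)_0$ the space $\mathcal S(\Lambda,\theta,l,l')$ is zero. -/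

import Mathlib

namespace SplitBessel

noncomputable section

open Matrix Topology
open scoped ContDiff

/-- Indices of `4 × 4` matrices, in `2 + 2` block form. -/
abbrev I4 := Fin 2 ⊕ Fin 2

/-! ### The group `GSp(4, ℝ)` -/

/-- `GSp(4, ℝ)`: invertible `g` with `ᵗg J g = μ J` for some scalar `μ`, where `J` is the standard
alternating matrix (replacing `J` by `-J` does not change the condition). -/
def GSp4 : Subgroup (GL I4 ℝ) where
  carrier := {g | ∃ μ : ℝ, (g : Matrix I4 I4 ℝ)ᵀ * J (Fin 2) ℝ * (g : Matrix I4 I4 ℝ)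
    = μ • J (Fin 2) ℝ}
  one_mem' := ⟨1, by simp⟩
  mul_mem' := by
    rintro a b ⟨x, hx⟩ ⟨y, hy⟩
    refine ⟨x * y, ?_⟩
    calc ((a * b : GL I4 ℝ) : Matrix I4 I4 ℝ)ᵀ * J (Fin 2) ℝ * ((a * b : GL I4 ℝ) : Matrix I4 I4 ℝ)
        = (b : Matrix I4 I4 ℝ)ᵀ * ((a : Matrix I4 I4 ℝ)ᵀ * J (Fin 2) ℝ * (a : Matrix I4 I4 ℝ))
          * (b : Matrix I4 I4 ℝ) := by
          simp only [Units.val_mul, transpose_mul, Matrix.mul_assoc]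
      _ = (x * y) • J (Fin 2) ℝ := by
          rw [hx, Matrix.mul_smul, Matrix.smul_mul, hy, smul_smul]
  inv_mem' := by
    rintro a ⟨x, hx⟩
    have h1 : (a : Matrix I4 I4 ℝ) * ((a⁻¹ : GL I4 ℝ) : Matrix I4 I4 ℝ) = 1 := a.mul_inv
    have h2 : (((a⁻¹ : GL I4 ℝ) : Matrix I4 I4 ℝ))ᵀ * (a : Matrix I4 I4 ℝ)ᵀ = 1 := by
      rw [← transpose_mul, h1, transpose_one]
    have h3 : J (Fin 2) ℝ = x • ((((a⁻¹ : GL I4 ℝ) : Matrix I4 I4 ℝ))ᵀ * J (Fin 2) ℝ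
        * ((a⁻¹ : GL I4 ℝ) : Matrix I4 I4 ℝ)) := by
      calc J (Fin 2) ℝ = ((((a⁻¹ : GL I4 ℝ) : Matrix I4 I4 ℝ))ᵀ * (a : Matrix I4 I4 ℝ)ᵀ)
            * J (Fin 2) ℝ * ((a : Matrix I4 I4 ℝ) * ((a⁻¹ : GL I4 ℝ) : Matrix I4 I4 ℝ)) := by
            rw [h1, h2]; simp
        _ = (((a⁻¹ : GL I4 ℝ) : Matrix I4 I4 ℝ))ᵀ * ((a : Matrix I4 I4 ℝ)ᵀ * J (Fin 2) ℝ
            * (a : Matrix I4 I4 ℝ)) * ((a⁻¹ : GL I4 ℝ) : Matrix I4 I4 ℝ) := by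
            simp only [Matrix.mul_assoc]
        _ = _ := by rw [hx]; simp
    have hx0 : x ≠ 0 := by
      rintro rfl
      have := congrFun (congrFun h3 (Sum.inr 0)) (Sum.inl 0)
      simp [J, fromBlocks] at this
    refine ⟨x⁻¹, ?_⟩
    conv_rhs => rw [h3]
    rw [smul_smul, inv_mul_cancel₀ hx0, one_smul]

/-- The underlying `4 × 4` real matrix. -/
abbrev mat (g : GSp4) : Matrix I4 I4 ℝ := ((g : GL I4 ℝ) : Matrix I4 I4 ℝ)

/-- The multiplier `μ₂(g)`, read off from an entry of `ᵗg J g = μ₂(g) J`. -/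
def mult (g : GSp4) : ℝ := ((mat g)ᵀ * J (Fin 2) ℝ * mat g) (Sum.inr 0) (Sum.inl 0)

theorem mult_spec (g : GSp4) : (mat g)ᵀ * J (Fin 2) ℝ * mat g = mult g • J (Fin 2) ℝ := by
  obtain ⟨μ, hμ⟩ := g.2
  have : mult g = μ := by
    unfold mult
    rw [hμ]
    simp [J, fromBlocks]
  rw [this]
  exact hμ

/-! ### The unipotent radical `U`, the Levi component `L` and the torus `T` -/

/-- `U(ℝ)`: the matrices `[1, X; 0, 1]` with `X` symmetric. -/
def unip : Subgroup GSp4 where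
  carrier := {g | ∃ X : Matrix (Fin 2) (Fin 2) ℝ, X.IsSymm ∧ mat g = fromBlocks 1 X 0 1}
  one_mem' := ⟨0, by simp [IsSymm], by simp [mat]⟩
  mul_mem' := by
    rintro a b ⟨X, hX, ha⟩ ⟨Y, hY, hb⟩
    refine ⟨Y + X, hY.add hX, ?_⟩
    change mat a * mat b = _
    rw [ha, hb, fromBlocks_multiply]
    simp
  inv_mem' := by
    rintro a ⟨X, hX, ha⟩
    refine ⟨-X, hX.neg, ?_⟩
    have h : mat a * fromBlocks 1 (-X) 0 1 = 1 := by
      rw [ha, fromBlocks_multiply]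
      simp
    have h' : mat a⁻¹ * mat a = 1 := (a : GL I4 ℝ).inv_mul
    calc mat a⁻¹ = mat a⁻¹ * (mat a * fromBlocks 1 (-X) 0 1) := by rw [h, Matrix.mul_one]
      _ = _ := by rw [← Matrix.mul_assoc, h', Matrix.one_mul]

/-- The Levi component `L` of the Siegel parabolic: the matrices `[A, 0; 0, c ᵗA⁻¹]` with
`A ∈ GL(2, ℝ)` and `c ∈ ℝˣ`. -/
def levi : Subgroup GSp4 where
  carrier := {g | ∃ (A : GL (Fin 2) ℝ) (c : ℝˣ), mat g =
    fromBlocks (A : Matrix (Fin 2) (Fin 2) ℝ) 0 0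
      ((c : ℝ) • ((A⁻¹ : GL (Fin 2) ℝ) : Matrix (Fin 2) (Fin 2) ℝ)ᵀ)}
  one_mem' := ⟨1, 1, by simp [mat]⟩
  mul_mem' := by
    rintro a b ⟨A, c, ha⟩ ⟨A', c', hb⟩
    refine ⟨A * A', c * c', ?_⟩
    change mat a * mat b = _
    rw [ha, hb, fromBlocks_multiply]
    simp only [_root_.mul_inv_rev, Units.val_mul, transpose_mul, Matrix.smul_mul, Matrix.mul_smul,
      smul_smul, Matrix.mul_zero, Matrix.zero_mul, smul_zero, add_zero, zero_add, mul_comm (c' : ℝ)]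
  inv_mem' := by
    rintro a ⟨A, c, ha⟩
    refine ⟨A⁻¹, c⁻¹, ?_⟩
    have h1 : (A : Matrix (Fin 2) (Fin 2) ℝ) * ((A⁻¹ : GL (Fin 2) ℝ) : Matrix (Fin 2) (Fin 2) ℝ)
      = 1 := A.mul_inv
    have h2 : ((A⁻¹ : GL (Fin 2) ℝ) : Matrix (Fin 2) (Fin 2) ℝ)ᵀ
        * (A : Matrix (Fin 2) (Fin 2) ℝ)ᵀ = 1 := by
      rw [← transpose_mul, h1, transpose_one]
    have h : mat a * fromBlocks ((A⁻¹ : GL (Fin 2) ℝ) : Matrix (Fin 2) (Fin 2) ℝ) 0 0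
        (((c⁻¹ : ℝˣ) : ℝ) • (A : Matrix (Fin 2) (Fin 2) ℝ)ᵀ) = 1 := by
      rw [ha, fromBlocks_multiply, h1]
      simp only [Matrix.smul_mul, Matrix.mul_smul, smul_smul, h2, Matrix.mul_zero,
        Matrix.zero_mul, smul_zero, add_zero, zero_add, Units.inv_mul, one_smul,
        fromBlocks_one]
    have h' : mat a⁻¹ * mat a = 1 := (a : GL I4 ℝ).inv_mul
    rw [inv_inv]
    calc mat a⁻¹ = mat a⁻¹ * (mat a * fromBlocks ((A⁻¹ : GL (Fin 2) ℝ) :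
          Matrix (Fin 2) (Fin 2) ℝ) 0 0 (((c⁻¹ : ℝˣ) : ℝ) • (A : Matrix (Fin 2) (Fin 2) ℝ)ᵀ)) := by
          rw [h, Matrix.mul_one]
      _ = _ := by rw [← Matrix.mul_assoc, h', Matrix.one_mul]

/-- The Levi component normalizes `U`. -/
theorem conj_mem_unip {g u : GSp4} (hg : g ∈ levi) (hu : u ∈ unip) : g * u * g⁻¹ ∈ unip := by
  obtain ⟨A', c', hi⟩ := levi.inv_mem hg
  obtain ⟨A, c, h⟩ := hg
  obtain ⟨X, hX, hu⟩ := hu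
  have h' : mat g * mat g⁻¹ = 1 := (g : GL I4 ℝ).mul_inv
  rw [h, hi, fromBlocks_multiply, ← fromBlocks_one, fromBlocks_inj] at h'
  obtain ⟨h1, -, -, h4⟩ := h'
  simp only [Matrix.mul_zero, add_zero, zero_add] at h1 h4
  have hA : ((A'⁻¹ : GL (Fin 2) ℝ) : Matrix (Fin 2) (Fin 2) ℝ) = A := by
    have : A * A' = 1 := Units.ext h1
    rw [← eq_inv_of_mul_eq_one_left this]
  refine ⟨(A : Matrix (Fin 2) (Fin 2) ℝ) * X * ((c' : ℝ) • (A : Matrix (Fin 2) (Fin 2) ℝ)ᵀ),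
    ?_, ?_⟩
  · simp only [IsSymm, transpose_mul, transpose_smul, transpose_transpose, hX.eq,
      Matrix.mul_smul, Matrix.mul_assoc]
  · change mat g * mat u * mat g⁻¹ = _
    rw [h, hi, hu, fromBlocks_multiply, fromBlocks_multiply]
    rw [hA] at h4 ⊢
    simp only [Matrix.mul_zero, Matrix.zero_mul, add_zero, zero_add, Matrix.mul_one, h1, h4]

/-- The character `θ([1, X; 0, 1]) = exp(2πi tr(SX))` of `U(ℝ)`. -/
def theta (S : Matrix (Fin 2) (Fin 2) ℝ) (u : unip) : ℂ :=
  Complex.exp (2 * Real.pi * Complex.I * ((S * (mat u).toBlocks₁₂).trace : ℝ))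

/-- `T(ℝ) = {g ∈ L : θ(u) = θ(g u g⁻¹) for all u ∈ U(ℝ)}`. -/
def torus (S : Matrix (Fin 2) (Fin 2) ℝ) : Subgroup GSp4 where
  carrier := {g | ∃ hg : g ∈ levi, ∀ u : unip, theta S u = theta S ⟨g * u * g⁻¹,
    conj_mem_unip hg u.2⟩}
  one_mem' := ⟨levi.one_mem, fun u => by congr 1; ext1; simp⟩
  mul_mem' := by
    rintro a b ⟨ha, ha'⟩ ⟨hb, hb'⟩
    refine ⟨levi.mul_mem ha hb, fun u => ?_⟩
    rw [hb' u, ha' ⟨_, conj_mem_unip hb u.2⟩]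
    congr 1
    ext1
    simp only [_root_.mul_inv_rev, mul_assoc]
  inv_mem' := by
    rintro a ⟨ha, ha'⟩
    refine ⟨levi.inv_mem ha, fun u => ?_⟩
    rw [ha' ⟨_, conj_mem_unip (levi.inv_mem ha) u.2⟩]
    congr 1
    ext1
    simp only [inv_inv]
    group

/-- `T(ℝ)₀`: the identity component of `T(ℝ)` in the real topology. -/
def torus₀ (S : Matrix (Fin 2) (Fin 2) ℝ) : Subgroup (torus S) :=
  Subgroup.connectedComponentOfOne (torus S)

/-! ### The maximal compact subgroup, growth and smoothness -/

/-- The standard maximal compact subgroup `K` of `GSp(4, ℝ)`: its orthogonal matrices. -/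
def maxCompact : Subgroup GSp4 where
  carrier := {g | (mat g)ᵀ * mat g = 1}
  one_mem' := by simp [mat]
  mul_mem' := by
    intro a b ha hb
    change (mat a * mat b)ᵀ * (mat a * mat b) = 1
    have ha' : (mat a)ᵀ * mat a = 1 := ha
    have hb' : (mat b)ᵀ * mat b = 1 := hb
    rw [transpose_mul, Matrix.mul_assoc, ← Matrix.mul_assoc (mat a)ᵀ, ha', Matrix.one_mul, hb']
  inv_mem' := by
    intro a ha
    have ha' : (mat a)ᵀ * mat a = 1 := ha
    have h : mat a * mat a⁻¹ = 1 := (a : GL I4 ℝ).mul_inv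
    have h2 : mat a⁻¹ = (mat a)ᵀ := by
      calc mat a⁻¹ = ((mat a)ᵀ * mat a) * mat a⁻¹ := by rw [ha', Matrix.one_mul]
        _ = (mat a)ᵀ := by rw [Matrix.mul_assoc, h, Matrix.mul_one]
    change (mat a⁻¹)ᵀ * mat a⁻¹ = 1
    rw [h2, transpose_transpose, ← h2, h]

/-- `B` is `K`-finite: its right translates by `K` span a finite-dimensional space. -/
def IsKFinite (B : GSp4 → ℂ) : Prop :=
  FiniteDimensional ℂ
    (Submodule.span ℂ (Set.range fun (k : maxCompact) (g : GSp4) => B (g * k)))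

/-- `‖g‖ = (μ₂(g)⁻² + ∑ gᵢⱼ²)^(1/2)`. -/
def groupNorm (g : GSp4) : ℝ :=
  Real.sqrt ((mult g ^ 2)⁻¹ + ∑ i, ∑ j, mat g i j ^ 2)

/-- `B` is slowly increasing (of moderate growth). -/
def IsSlowlyIncreasing (B : GSp4 → ℂ) : Prop :=
  ∃ α β : ℝ, 0 < α ∧ 0 < β ∧ ∀ g : GSp4, ‖B g‖ ≤ α * groupNorm g ^ β

/-- `B` is smooth on the Lie group `GSp(4, ℝ)`. As this is an embedded submanifold of the space
`ℝ¹⁶` of matrices, this means that `B` is locally the restriction of smooth functions on `ℝ¹⁶`. -/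
def IsSmooth (B : GSp4 → ℂ) : Prop :=
  ∀ g : GSp4, ∃ F : (I4 → I4 → ℝ) → ℂ, ContDiff ℝ ∞ F ∧
    ∀ᶠ h in 𝓝 g, B h = F (fun i j => mat h i j)

/-! ### The Lie algebra and its action by right translation

`LieAlgebra.Symplectic.sp (Fin 2) ℝ` is the Lie algebra `𝔤¹` of `Sp(4, ℝ)`, and
`LieAlgebra.Symplectic.sp (Fin 2) ℂ` is its complexification. -/

theorem mem_sp_iff {R : Type} [CommRing R] (X : Matrix I4 I4 R) :
    X ∈ LieAlgebra.Symplectic.sp (Fin 2) R ↔ Xᵀ * J (Fin 2) R = J (Fin 2) R * -X := by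
  rw [LieAlgebra.Symplectic.sp, mem_skewAdjointMatricesLieSubalgebra,
    mem_skewAdjointMatricesSubmodule]
  rfl

theorem exp_mem_GSp4 {X : Matrix I4 I4 ℝ} (hX : X ∈ LieAlgebra.Symplectic.sp (Fin 2) ℝ) :
    (Matrix.isUnit_exp X).unit ∈ GSp4 := by
  rw [mem_sp_iff] at hX
  refine ⟨1, ?_⟩
  have hJ : J (Fin 2) ℝ * -J (Fin 2) ℝ = 1 := by
    rw [Matrix.mul_neg, J_squared, neg_neg]
  have hJ' : -J (Fin 2) ℝ * J (Fin 2) ℝ = 1 := by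
    rw [Matrix.neg_mul, J_squared, neg_neg]
  have hu : IsUnit (J (Fin 2) ℝ) := ⟨⟨_, _, hJ, hJ'⟩, rfl⟩
  have hinv : (J (Fin 2) ℝ)⁻¹ = -J (Fin 2) ℝ := Matrix.inv_eq_right_inv hJ
  have h1 : Xᵀ = J (Fin 2) ℝ * -X * (J (Fin 2) ℝ)⁻¹ := by
    rw [← hX, hinv, Matrix.mul_assoc, hJ, Matrix.mul_one]
  have hdet : IsUnit (NormedSpace.exp X).det :=
    (Matrix.isUnit_iff_isUnit_det _).1 (Matrix.isUnit_exp X)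
  rw [IsUnit.unit_spec, one_smul, ← Matrix.exp_transpose, h1, Matrix.exp_conj _ _ hu,
    Matrix.exp_neg, hinv, Matrix.mul_assoc _ (-J (Fin 2) ℝ), hJ', Matrix.mul_one,
    Matrix.mul_assoc, Matrix.nonsing_inv_mul _ hdet, Matrix.mul_one]

/-- The exponential map from the Lie algebra `𝔤¹` into the group. -/
def expG (X : LieAlgebra.Symplectic.sp (Fin 2) ℝ) : GSp4 := ⟨_, exp_mem_GSp4 X.2⟩

/-- `(X.B)(g) = d/dt|₀ B(g exp(tX))` for `X` in the real Lie algebra. -/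
def realAct (X : LieAlgebra.Symplectic.sp (Fin 2) ℝ) (B : GSp4 → ℂ) (g : GSp4) : ℂ :=
  deriv (fun t : ℝ => B (g * expG (t • X))) 0

/-- The real part of an element of the complexified Lie algebra. -/
def rePart (W : LieAlgebra.Symplectic.sp (Fin 2) ℂ) : LieAlgebra.Symplectic.sp (Fin 2) ℝ :=
  ⟨(W : Matrix I4 I4 ℂ).map Complex.re, by
    have h := (mem_sp_iff _).1 W.2
    rw [mem_sp_iff]
    ext i j
    have := congrArg Complex.re (congrFun (congrFun h i) j)
    rcases i with i | i <;> rcases j with j | j <;> fin_cases i <;> fin_cases j <;>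
      simp [Matrix.mul_apply, J, fromBlocks] at this ⊢ <;> exact this⟩

/-- The imaginary part of an element of the complexified Lie algebra. -/
def imPart (W : LieAlgebra.Symplectic.sp (Fin 2) ℂ) : LieAlgebra.Symplectic.sp (Fin 2) ℝ :=
  ⟨(W : Matrix I4 I4 ℂ).map Complex.im, by
    have h := (mem_sp_iff _).1 W.2
    rw [mem_sp_iff]
    ext i j
    have := congrArg Complex.im (congrFun (congrFun h i) j)
    rcases i with i | i <;> rcases j with j | j <;> fin_cases i <;> fin_cases j <;>
      simp [Matrix.mul_apply, J, fromBlocks] at this ⊢ <;> exact this⟩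

/-- The complex-linear extension of the action: `(X + iY).B = X.B + i (Y.B)`. -/
def act (W : LieAlgebra.Symplectic.sp (Fin 2) ℂ) (B : GSp4 → ℂ) (g : GSp4) : ℂ :=
  realAct (rePart W) B g + Complex.I * realAct (imPart W) B g

/-- Block matrices `[A, B; C, D]` with `D = -ᵗA` and `B`, `C` symmetric lie in `𝔤¹`. -/
theorem blocks_mem_sp (A B C D : Matrix (Fin 2) (Fin 2) ℂ) (hD : D = -Aᵀ) (hB : Bᵀ = B)
    (hC : Cᵀ = C) : fromBlocks A B C D ∈ LieAlgebra.Symplectic.sp (Fin 2) ℂ := by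
  rw [mem_sp_iff, J, fromBlocks_transpose, fromBlocks_neg, fromBlocks_multiply,
    fromBlocks_multiply, hD, hB, hC]
  simp

/-- The element `Z`. -/
def Z : LieAlgebra.Symplectic.sp (Fin 2) ℂ :=
  ⟨fromBlocks 0 !![-Complex.I, 0; 0, 0] !![Complex.I, 0; 0, 0] 0, by
    apply blocks_mem_sp <;> ext i j <;> fin_cases i <;> fin_cases j <;> simp⟩

/-- The element `Z'`. -/
def Z' : LieAlgebra.Symplectic.sp (Fin 2) ℂ :=
  ⟨fromBlocks 0 !![0, 0; 0, -Complex.I] !![0, 0; 0, Complex.I] 0, by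
    apply blocks_mem_sp <;> ext i j <;> fin_cases i <;> fin_cases j <;> simp⟩

/-- The element `N₊`. -/
def Nplus : LieAlgebra.Symplectic.sp (Fin 2) ℂ :=
  (1 / 2 : ℂ) • ⟨fromBlocks !![0, 1; -1, 0] !![0, -Complex.I; -Complex.I, 0]
    !![0, Complex.I; Complex.I, 0] !![0, 1; -1, 0], by
    apply blocks_mem_sp <;> ext i j <;> fin_cases i <;> fin_cases j <;> simp⟩

/-- The element `X₋`. -/
def Xminus : LieAlgebra.Symplectic.sp (Fin 2) ℂ :=
  (1 / 2 : ℂ) • ⟨fromBlocks !![1, 0; 0, 0] !![-Complex.I, 0; 0, 0]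
    !![-Complex.I, 0; 0, 0] !![-1, 0; 0, 0], by
    apply blocks_mem_sp <;> ext i j <;> fin_cases i <;> fin_cases j <;> simp⟩

/-- The element `P₁₋`. -/
def P1minus : LieAlgebra.Symplectic.sp (Fin 2) ℂ :=
  (1 / 2 : ℂ) • ⟨fromBlocks !![0, 1; 1, 0] !![0, -Complex.I; -Complex.I, 0]
    !![0, -Complex.I; -Complex.I, 0] !![0, -1; -1, 0], by
    apply blocks_mem_sp <;> ext i j <;> fin_cases i <;> fin_cases j <;> simp⟩

/-- The element `P₀₋`. -/
def P0minus : LieAlgebra.Symplectic.sp (Fin 2) ℂ :=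
  (1 / 2 : ℂ) • ⟨fromBlocks !![0, 0; 0, 1] !![0, 0; 0, -Complex.I]
    !![0, 0; 0, -Complex.I] !![0, 0; 0, -1], by
    apply blocks_mem_sp <;> ext i j <;> fin_cases i <;> fin_cases j <;> simp⟩

/-! ### The space of Bessel functions -/

/-- The defining conditions of `𝒮(Λ, θ, l, l')`, where `θ` is given by `S` and `Λ` is a
(continuous) character of `T(ℝ)₀`. -/
structure IsBesselFunction (S : Matrix (Fin 2) (Fin 2) ℝ) (Λ : torus₀ S →ₜ* ℂˣ) (l l' : ℤ)
    (B : GSp4 → ℂ) : Prop where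
  smooth : IsSmooth B
  kFinite : IsKFinite B
  transform : ∀ (t : torus₀ S) (u : unip) (g : GSp4),
    B (((t : torus S) : GSp4) * u * g) = (Λ t : ℂ) * theta S u * B g
  slowlyIncreasing : IsSlowlyIncreasing B
  weight_Z : ∀ g, act Z B g = (l : ℂ) * B g
  weight_Z' : ∀ g, act Z' B g = (l' : ℂ) * B g
  act_Nplus : ∀ g, act Nplus B g = 0
  act_Xminus : ∀ g, act Xminus B g = 0
  act_P1minus : ∀ g, act P1minus B g = 0
  act_P0minus : ∀ g, act P0minus B g = 0

/-- The space `𝒮(Λ, θ, l, l')` of functions `GSp(4, ℝ) → ℂ`. -/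
def besselSpace (S : Matrix (Fin 2) (Fin 2) ℝ) (Λ : torus₀ S →ₜ* ℂˣ) (l l' : ℤ) :
    Set (GSp4 → ℂ) :=
  {B | IsBesselFunction S Λ l l' B}

end

end SplitBessel

namespace SplitBessel

noncomputable section

open Matrix Topology
open scoped ContDiff

/-! The theorem is an instance of the Koecher principle. Annihilation by `𝔭⁻` is a Cauchy–Riemann
system. For a symmetric projection `E`, the real part of `lowering E` is the Levi direction `diag(E,
-E)`, and its imaginary part is the rotation `[0, E; -E, 0]` minus twice the unipotent direction
`[0, E; 0, 0]`. At `m · exp(s diag(E, -E))` with `m = [A, 0; 0, c ᵗA⁻¹]`, equivariance under `θ`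
turns the unipotent derivative into multiplication by `2πi q e^{2s}`, where `q = c⁻¹ tr(ᵗA S A E)`.
Hence the Levi derivative of `f` is `-4πq e^{2s} f - i · rotDeriv f`
(`hasDerivAt_leviCurve_of_mem`).

By `K`-finiteness, `B` lies in a finite-dimensional space stable under `rotDeriv` (`rotDeriv_mem`),
so on a basis this is a linear system `Φ' = (a e^{2s} + M) Φ` with `M` constant and `a = -4πq`. As
`ᵗA S A` is indefinite, `E` can be chosen with `q < 0` (`exists_projection`). A nonzero solution
would then grow like `exp((a/2) e^{2s})` up to exponential factors, whereas moderate growth allows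
only `e^{ns}` (`eq_zero_of_hasDerivAt_of_le_exp`). So the whole space vanishes on the Levi component
(`eq_zero_of_mem_levi`). It is stable under translation by `U(2)`, which normalizes `𝔭⁻`, and the
decomposition `G = U · L · U(2)` (`exists_iwasawa`) gives `B = 0`. -/

/-! ### Constructing elements of `GSp(4, ℝ)` -/

theorem neg_J_mul_J : -J (Fin 2) ℝ * J (Fin 2) ℝ = 1 := by
  rw [Matrix.neg_mul, J_squared, neg_neg]

/-- The element of `GSp(4, ℝ)` given by a matrix with `ᵗM J M = μ J`, `μ ≠ 0`. -/
def ofMatrix (M : Matrix I4 I4 ℝ) (μ : ℝ) (hμ : μ ≠ 0)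
    (h : Mᵀ * J (Fin 2) ℝ * M = μ • J (Fin 2) ℝ) : GSp4 :=
  have h1 : (μ⁻¹ • (-J (Fin 2) ℝ * Mᵀ * J (Fin 2) ℝ)) * M = 1 := by
    rw [Matrix.smul_mul, Matrix.mul_assoc, Matrix.mul_assoc, ← Matrix.mul_assoc Mᵀ, h,
      Matrix.mul_smul, smul_smul, inv_mul_cancel₀ hμ, one_smul, neg_J_mul_J]
  ⟨⟨M, μ⁻¹ • (-J (Fin 2) ℝ * Mᵀ * J (Fin 2) ℝ), mul_eq_one_comm.1 h1, h1⟩, μ, h⟩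

@[simp] theorem mat_ofMatrix (M : Matrix I4 I4 ℝ) (μ : ℝ) (hμ : μ ≠ 0)
    (h : Mᵀ * J (Fin 2) ℝ * M = μ • J (Fin 2) ℝ) : mat (ofMatrix M μ hμ h) = M := rfl

theorem mat_mul (g h : GSp4) : mat (g * h) = mat g * mat h := rfl

theorem mat_one : mat 1 = 1 := rfl

theorem mat_injective : Function.Injective mat := fun _ _ h => Subtype.ext (Units.ext h)

theorem mat_mul_inv (g : GSp4) : mat g * mat g⁻¹ = 1 := (g : GL I4 ℝ).mul_inv

theorem mat_inv_mul (g : GSp4) : mat g⁻¹ * mat g = 1 := (g : GL I4 ℝ).inv_mul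

theorem mult_eq_of {g : GSp4} {μ : ℝ}
    (h : (mat g)ᵀ * J (Fin 2) ℝ * mat g = μ • J (Fin 2) ℝ) : mult g = μ := by
  unfold mult
  rw [h]
  simp [J, fromBlocks]

theorem mult_mul (g h : GSp4) : mult (g * h) = mult g * mult h := by
  apply mult_eq_of
  calc (mat (g * h))ᵀ * J (Fin 2) ℝ * mat (g * h)
      = (mat h)ᵀ * ((mat g)ᵀ * J (Fin 2) ℝ * mat g) * mat h := by
        simp only [mat_mul, transpose_mul, Matrix.mul_assoc]
    _ = _ := by rw [mult_spec, Matrix.mul_smul, Matrix.smul_mul, mult_spec, smul_smul]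

theorem mult_ne_zero (g : GSp4) : mult g ≠ 0 := by
  intro h
  have h1 : mult (g * g⁻¹) = 0 := by rw [mult_mul, h, zero_mul]
  have h2 : mult (g * g⁻¹) = 1 := by
    rw [mul_inv_cancel]
    apply mult_eq_of
    simp [mat_one]
  exact one_ne_zero (h2.symm.trans h1)

/-- For orthogonal `k`, `ᵗk J k` is a conjugate of `J`, so `μ J` still squares to `-1`. -/
theorem mult_sq_of_mem_maxCompact {k : GSp4} (hk : k ∈ maxCompact) : mult k ^ 2 = 1 := by
  have hk' : (mat k)ᵀ * mat k = 1 := hk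
  have hk2 : mat k * (mat k)ᵀ = 1 := mul_eq_one_comm.1 hk'
  have h : ((mat k)ᵀ * J (Fin 2) ℝ * mat k) * ((mat k)ᵀ * J (Fin 2) ℝ * mat k) = -1 := by
    calc ((mat k)ᵀ * J (Fin 2) ℝ * mat k) * ((mat k)ᵀ * J (Fin 2) ℝ * mat k)
        = (mat k)ᵀ * J (Fin 2) ℝ * (mat k * (mat k)ᵀ) * J (Fin 2) ℝ * mat k := by
          simp only [Matrix.mul_assoc]
      _ = (mat k)ᵀ * (J (Fin 2) ℝ * J (Fin 2) ℝ) * mat k := by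
          rw [hk2, Matrix.mul_one]; simp only [Matrix.mul_assoc]
      _ = -1 := by rw [J_squared]; simp [hk']
  rw [mult_spec, Matrix.smul_mul, Matrix.mul_smul, smul_smul, J_squared] at h
  have := congrFun (congrFun h (Sum.inl 0)) (Sum.inl 0)
  simp at this
  linarith [sq (mult k)]

theorem sum_sq_eq_trace (M : Matrix I4 I4 ℝ) : ∑ i, ∑ j, M i j ^ 2 = (M * Mᵀ).trace := by
  simp only [Matrix.trace, Matrix.diag, Matrix.mul_apply, transpose_apply, sq]

/-- The sum of squares is `tr(g ᵗg)`, which does not see an orthogonal right factor. This carries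
growth bounds over to `K`-translates. -/
theorem groupNorm_mul_of_mem_maxCompact (g : GSp4) {k : GSp4} (hk : k ∈ maxCompact) :
    groupNorm (g * k) = groupNorm g := by
  have hk2 : mat k * (mat k)ᵀ = 1 := mul_eq_one_comm.1 hk
  have h : mat g * mat k * (mat g * mat k)ᵀ = mat g * (mat g)ᵀ := by
    rw [transpose_mul, Matrix.mul_assoc, ← Matrix.mul_assoc (mat k), hk2, Matrix.one_mul]
  unfold groupNorm
  rw [mult_mul, mul_pow, mult_sq_of_mem_maxCompact hk, mul_one, sum_sq_eq_trace,
    sum_sq_eq_trace, mat_mul, h]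

/-! ### Curves and differentials -/

/-- A curve in `GSp(4, ℝ)` is continuous as soon as its matrix entries are. -/
theorem continuousAt_of_entries {γ : ℝ → GSp4} {t₀ : ℝ}
    (h : ∀ i j, ContinuousAt (fun t => mat (γ t) i j) t₀) : ContinuousAt γ t₀ := by
  let _ : NormedRing (Matrix I4 I4 ℝ) := Matrix.linftyOpNormedRing
  let _ : NormedAlgebra ℝ (Matrix I4 I4 ℝ) := Matrix.linftyOpNormedAlgebra
  have : CompleteSpace (Matrix I4 I4 ℝ) := inferInstance
  -- The topology of a unit group also records the inverse; in a complete normed ring the value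
  -- alone already determines it.
  have he : IsEmbedding (Units.val : GL I4 ℝ → Matrix I4 I4 ℝ) :=
    (Units.isOpenEmbedding_val (R := Matrix I4 I4 ℝ)).isEmbedding
  rw [(IsEmbedding.subtypeVal (p := (· ∈ GSp4))).continuousAt_iff, he.continuousAt_iff]
  exact continuousAt_pi.2 fun i => continuousAt_pi.2 fun j => h i j

/-- `D` is a differential of `f` at `g`: it computes the derivatives of `f` along curves in the
group through `g`. -/
def HasDifferential (f : GSp4 → ℂ) (D : Matrix I4 I4 ℝ →ₗ[ℝ] ℂ) (g : GSp4) : Prop :=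
  ∀ (γ : ℝ → GSp4) (t₀ : ℝ) (M : Matrix I4 I4 ℝ), γ t₀ = g →
    (∀ i j, HasDerivAt (fun t => mat (γ t) i j) (M i j) t₀) →
    HasDerivAt (fun t => f (γ t)) (D M) t₀

/-- The derivative of a local extension `F` to matrix space serves as `D`. Off the tangent space it
depends on `F`, which is harmless because only tangent vectors of curves in the group are tested. -/
theorem IsSmooth.exists_hasDifferential {B : GSp4 → ℂ} (hB : IsSmooth B) (g : GSp4) :
    ∃ D, HasDifferential B D g := by
  obtain ⟨F, hF, hFB⟩ := hB g
  refine ⟨(fderiv ℝ F (fun i j => mat g i j)).toLinearMap, ?_⟩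
  intro γ t₀ M hγ hM
  have hc : ContinuousAt γ t₀ := continuousAt_of_entries fun i j => (hM i j).continuousAt
  have h1 : HasDerivAt (fun t i j => mat (γ t) i j) (fun i j => M i j) t₀ :=
    hasDerivAt_pi.2 fun i => hasDerivAt_pi.2 fun j => hM i j
  have h2 : HasFDerivAt F (fderiv ℝ F (fun i j => mat g i j)) (fun i j => mat (γ t₀) i j) := by
    rw [hγ]
    exact (hF.differentiable (by simp)).differentiableAt.hasFDerivAt
  refine (h2.comp_hasDerivAt t₀ h1).congr_of_eventuallyEq ?_
  rw [← hγ] at hFB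
  exact hc.eventually hFB

theorem hasDerivAt_mul_entries (g k : GSp4) {γ : ℝ → GSp4} {t₀ : ℝ} {M : Matrix I4 I4 ℝ}
    (hM : ∀ i j, HasDerivAt (fun t => mat (γ t) i j) (M i j) t₀) (i j : I4) :
    HasDerivAt (fun t => mat (g * γ t * k) i j) ((mat g * M * mat k) i j) t₀ := by
  simp only [mat_mul, Matrix.mul_apply]
  exact HasDerivAt.fun_sum fun a _ => (HasDerivAt.fun_sum fun b _ =>
    (hM b a).const_mul _).mul_const _

theorem hasDerivAt_expG (X : LieAlgebra.Symplectic.sp (Fin 2) ℝ) (i j : I4) :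
    HasDerivAt (fun t : ℝ => mat (expG (t • X)) i j) ((X : Matrix I4 I4 ℝ) i j) 0 := by
  let _ : NormedRing (Matrix I4 I4 ℝ) := Matrix.linftyOpNormedRing
  let _ : NormedAlgebra ℝ (Matrix I4 I4 ℝ) := Matrix.linftyOpNormedAlgebra
  have : CompleteSpace (Matrix I4 I4 ℝ) := inferInstance
  have h := hasDerivAt_exp_smul_const (𝕂 := ℝ) (X : Matrix I4 I4 ℝ) (0 : ℝ)
  rw [zero_smul, NormedSpace.exp_zero, one_mul] at h
  exact hasDerivAt_pi.1 (hasDerivAt_pi.1 h i) j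

/-- The complex-linear extension of `X ↦ D (g X)`. -/
def complexDiff (D : Matrix I4 I4 ℝ →ₗ[ℝ] ℂ) (g : GSp4) : Matrix I4 I4 ℂ →ₗ[ℂ] ℂ where
  toFun W := D (mat g * W.map Complex.re) + Complex.I * D (mat g * W.map Complex.im)
  map_add' V W := by
    have h1 : (V + W).map Complex.re = V.map Complex.re + W.map Complex.re := by
      ext; simp
    have h2 : (V + W).map Complex.im = V.map Complex.im + W.map Complex.im := by
      ext; simp
    rw [h1, h2, Matrix.mul_add, Matrix.mul_add, map_add, map_add]
    ring
  map_smul' c W := by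
    have h1 : (c • W).map Complex.re = c.re • W.map Complex.re - c.im • W.map Complex.im := by
      ext; simp
    have h2 : (c • W).map Complex.im = c.re • W.map Complex.im + c.im • W.map Complex.re := by
      ext; simp
    rw [h1, h2, Matrix.mul_sub, Matrix.mul_add, map_sub, map_add]
    simp only [Matrix.mul_smul, map_smul, Complex.real_smul, RingHom.id_apply, smul_eq_mul]
    conv_rhs => rw [← Complex.re_add_im c]
    linear_combination (-(c.im : ℂ) * D (mat g * W.map Complex.im)) * Complex.I_sq

theorem HasDifferential.realAct_eq {f : GSp4 → ℂ} {D : Matrix I4 I4 ℝ →ₗ[ℝ] ℂ} {g : GSp4}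
    (h : HasDifferential f D g) (X : LieAlgebra.Symplectic.sp (Fin 2) ℝ) :
    realAct X f g = D (mat g * X) := by
  have h1 := h (fun t => g * expG (t • X)) 0 (mat g * X) (by
    have : expG ((0 : ℝ) • X) = 1 := by
      apply mat_injective
      simp [expG, mat, NormedSpace.exp_zero]
    rw [this, mul_one]) (fun i j => by
      simpa [mat_one] using hasDerivAt_mul_entries g 1 (hasDerivAt_expG X) i j)
  exact h1.deriv

theorem HasDifferential.act_eq {f : GSp4 → ℂ} {D : Matrix I4 I4 ℝ →ₗ[ℝ] ℂ} {g : GSp4}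
    (h : HasDifferential f D g) (W : LieAlgebra.Symplectic.sp (Fin 2) ℂ) :
    act W f g = complexDiff D g W := by
  unfold act
  rw [h.realAct_eq, h.realAct_eq]
  rfl

/-! ### The lowering operators and their conjugation by `U(2)` -/

/-- The element `[E, -iE; -iE, -E]` of `𝔭⁻`, for a symmetric matrix `E`. -/
def lowering (E : Matrix (Fin 2) (Fin 2) ℂ) : Matrix I4 I4 ℂ :=
  fromBlocks E (-(Complex.I • E)) (-(Complex.I • E)) (-E)

/-- `f` is differentiable and annihilated by `𝔭⁻`. -/
def IsHolomorphic (f : GSp4 → ℂ) : Prop :=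
  ∀ g, ∃ D, HasDifferential f D g ∧
    ∀ E : Matrix (Fin 2) (Fin 2) ℂ, E.IsSymm → complexDiff D g (lowering E) = 0

theorem isHolomorphic_of_act_eq_zero {B : GSp4 → ℂ} (hB : IsSmooth B)
    (hX : ∀ g, act Xminus B g = 0) (h1 : ∀ g, act P1minus B g = 0)
    (h0 : ∀ g, act P0minus B g = 0) : IsHolomorphic B := by
  intro g
  obtain ⟨D, hD⟩ := hB.exists_hasDifferential g
  refine ⟨D, hD, fun E hE => ?_⟩
  have hE' : E 1 0 = E 0 1 := hE.apply 0 1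
  -- `X₋`, `P₁₋`, `P₀₋` are half of `lowering` at `e₁`, `w`, `e₂`, a basis of the symmetric
  -- matrices; hence the factors 2.
  have key : lowering E = (2 * E 0 0) • (Xminus : Matrix I4 I4 ℂ)
      + (2 * E 0 1) • (P1minus : Matrix I4 I4 ℂ) + (2 * E 1 1) • (P0minus : Matrix I4 I4 ℂ) := by
    ext i j
    rcases i with i | i <;> rcases j with j | j <;> fin_cases i <;> fin_cases j <;>
      simp [lowering, Xminus, P1minus, P0minus, hE'] <;> ring
  rw [key, map_add, map_add, map_smul, map_smul, map_smul, ← hD.act_eq, ← hD.act_eq,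
    ← hD.act_eq, hX, h1, h0]
  simp

theorem IsHolomorphic.zero : IsHolomorphic 0 := fun g =>
  ⟨0, fun γ t₀ M _ _ => by simpa using hasDerivAt_const t₀ (0 : ℂ), fun E _ => by
    simp [complexDiff]⟩

theorem IsHolomorphic.add {f f' : GSp4 → ℂ} (hf : IsHolomorphic f) (hf' : IsHolomorphic f') :
    IsHolomorphic (f + f') := by
  intro g
  obtain ⟨D, hD, hE⟩ := hf g
  obtain ⟨D', hD', hE'⟩ := hf' g
  refine ⟨D + D', fun γ t₀ M h1 h2 => (hD γ t₀ M h1 h2).add (hD' γ t₀ M h1 h2), fun E h => ?_⟩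
  have h1 := hE E h
  have h2 := hE' E h
  simp only [complexDiff, LinearMap.coe_mk, AddHom.coe_mk, LinearMap.add_apply] at h1 h2 ⊢
  linear_combination h1 + h2

theorem IsHolomorphic.smul {f : GSp4 → ℂ} (c : ℂ) (hf : IsHolomorphic f) :
    IsHolomorphic (c • f) := by
  intro g
  obtain ⟨D, hD, hE⟩ := hf g
  refine ⟨c • D, fun γ t₀ M h1 h2 => (hD γ t₀ M h1 h2).const_mul c, fun E h => ?_⟩
  have h1 := hE E h
  simp only [complexDiff, LinearMap.coe_mk, AddHom.coe_mk, LinearMap.smul_apply,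
    smul_eq_mul] at h1 ⊢
  linear_combination c * h1

/-- The identity component `U(2)` of `K`, as a set of matrices `[x, y; -y, x]`. -/
def IsUnitaryBlock (k : GSp4) : Prop :=
  k ∈ maxCompact ∧ ∃ x y : Matrix (Fin 2) (Fin 2) ℝ, mat k = fromBlocks x y (-y) x

/-- In blocks, `lowering E` is the column `ᵗ[1, -i]` times `E` times the row `[1, -i]`, and `[1, -i]
k = (x + iy) [1, -i]` for `k = [x, y; -y, x]`. -/
theorem lowering_conj {x y : Matrix (Fin 2) (Fin 2) ℝ} (E : Matrix (Fin 2) (Fin 2) ℂ) :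
    (fromBlocks x y (-y) x)ᵀ.map Complex.ofReal * lowering E
        * (fromBlocks x y (-y) x).map Complex.ofReal
      = lowering ((x.map Complex.ofReal + Complex.I • y.map Complex.ofReal)ᵀ * E
        * (x.map Complex.ofReal + Complex.I • y.map Complex.ofReal)) := by
  have hI := Complex.I_mul_I
  simp only [lowering, fromBlocks_transpose, fromBlocks_map, fromBlocks_multiply]
  have e1 : (-y).map Complex.ofReal = -y.map Complex.ofReal := by ext; simp
  have e2 : (-y)ᵀ.map Complex.ofReal = -(y.map Complex.ofReal)ᵀ := by ext; simp
  have e3 : xᵀ.map Complex.ofReal = (x.map Complex.ofReal)ᵀ := rfl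
  have e4 : yᵀ.map Complex.ofReal = (y.map Complex.ofReal)ᵀ := rfl
  rw [e1, e2, e3, e4]
  generalize x.map Complex.ofReal = x'
  generalize y.map Complex.ofReal = y'
  congr 1 <;>
  · simp only [transpose_add, transpose_smul, Matrix.add_mul, Matrix.mul_add, Matrix.neg_mul,
      Matrix.mul_neg, Matrix.smul_mul, Matrix.mul_smul, smul_add, smul_neg, smul_smul, hI,
      neg_neg, neg_smul, one_smul, neg_add]
    try abel

theorem map_re_mul_ofReal (W : Matrix I4 I4 ℂ) (m : Matrix I4 I4 ℝ) :
    (W * m.map Complex.ofReal).map Complex.re = W.map Complex.re * m := by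
  ext i j; simp [Matrix.mul_apply]

theorem map_im_mul_ofReal (W : Matrix I4 I4 ℂ) (m : Matrix I4 I4 ℝ) :
    (W * m.map Complex.ofReal).map Complex.im = W.map Complex.im * m := by
  ext i j; simp [Matrix.mul_apply]

theorem map_re_ofReal_mul (W : Matrix I4 I4 ℂ) (m : Matrix I4 I4 ℝ) :
    (m.map Complex.ofReal * W).map Complex.re = m * W.map Complex.re := by
  ext i j; simp [Matrix.mul_apply]

theorem map_im_ofReal_mul (W : Matrix I4 I4 ℂ) (m : Matrix I4 I4 ℝ) :
    (m.map Complex.ofReal * W).map Complex.im = m * W.map Complex.im := by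
  ext i j; simp [Matrix.mul_apply]

/-- Since `ᵗk = k⁻¹`, one has `g W k = (g k)(ᵗk W k)`, and `lowering_conj` keeps `ᵗk W k` in `𝔭⁻`.
-/
theorem IsHolomorphic.translate {f : GSp4 → ℂ} (hf : IsHolomorphic f) {k : GSp4}
    (hk : IsUnitaryBlock k) : IsHolomorphic fun g => f (g * k) := by
  intro g
  obtain ⟨hk1, x, y, hxy⟩ := hk
  obtain ⟨D, hD, hE⟩ := hf (g * k)
  refine ⟨D ∘ₗ LinearMap.mulRight ℝ (mat k), fun γ t₀ M h1 h2 => ?_, fun E h => ?_⟩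
  · refine hD (fun t => γ t * k) t₀ (M * mat k) (by rw [h1]) fun i j => ?_
    simpa [mat_one] using hasDerivAt_mul_entries 1 k h2 i j
  · have hs : ((x.map Complex.ofReal + Complex.I • y.map Complex.ofReal)ᵀ * E
        * (x.map Complex.ofReal + Complex.I • y.map Complex.ofReal)).IsSymm := by
      simp only [IsSymm, transpose_mul, transpose_transpose, h.eq, Matrix.mul_assoc]
    have h3 := hE _ hs
    have hk2 : mat k * (mat k)ᵀ = 1 := mul_eq_one_comm.1 hk1
    rw [← lowering_conj, ← hxy] at h3
    simp only [complexDiff, LinearMap.coe_mk, AddHom.coe_mk, map_re_mul_ofReal,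
      map_im_mul_ofReal, map_re_ofReal_mul, map_im_ofReal_mul, LinearMap.comp_apply,
      LinearMap.mulRight_apply, mat_mul] at h3 ⊢
    have h4 : ∀ W : Matrix I4 I4 ℝ, mat g * mat k * ((mat k)ᵀ * W * mat k)
        = mat g * W * mat k := fun W => by
      calc mat g * mat k * ((mat k)ᵀ * W * mat k)
          = mat g * (mat k * (mat k)ᵀ) * W * mat k := by simp only [Matrix.mul_assoc]
        _ = _ := by rw [hk2, Matrix.mul_one]
    rwa [h4, h4] at h3

/-! ### Embedded copies of `SL(2, ℝ)` -/

/-- The embedding of the matrix `[p, q; r, s]` along a projection `E`. -/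
def slMatrix (E : Matrix (Fin 2) (Fin 2) ℝ) (p q r s : ℝ) : Matrix I4 I4 ℝ :=
  fromBlocks (1 + (p - 1) • E) (q • E) (r • E) (1 + (s - 1) • E)

theorem slMatrix_symplectic {E : Matrix (Fin 2) (Fin 2) ℝ} (hE : Eᵀ = E) (hE2 : E * E = E)
    {p q r s : ℝ} (h : p * s - q * r = 1) :
    (slMatrix E p q r s)ᵀ * J (Fin 2) ℝ * slMatrix E p q r s = (1 : ℝ) • J (Fin 2) ℝ := by
  simp only [slMatrix, J, fromBlocks_transpose, transpose_add, transpose_smul, transpose_one, hE,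
    fromBlocks_multiply, one_smul]
  congr 1 <;>
  · simp only [Matrix.add_mul, Matrix.mul_add, Matrix.smul_mul, Matrix.mul_smul, hE2,
      Matrix.mul_one, Matrix.one_mul, Matrix.mul_zero, Matrix.zero_mul, Matrix.mul_neg, Matrix.neg_mul]
    ext i j
    simp only [Matrix.add_apply, Matrix.smul_apply, Matrix.neg_apply, Matrix.zero_apply,
      smul_eq_mul, Matrix.one_apply]
    first | ring1 | linear_combination (E i j) * h | linear_combination (-E i j) * h

/-- The element of `GSp(4, ℝ)` given by `[p, q; r, s] ∈ SL(2, ℝ)` and a symmetric projection. -/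
def slEmbed (E : Matrix (Fin 2) (Fin 2) ℝ) (hE : Eᵀ = E) (hE2 : E * E = E) (p q r s : ℝ)
    (h : p * s - q * r = 1) : GSp4 :=
  ofMatrix (slMatrix E p q r s) 1 one_ne_zero (slMatrix_symplectic hE hE2 h)

theorem mat_slEmbed (E : Matrix (Fin 2) (Fin 2) ℝ) (hE : Eᵀ = E) (hE2 : E * E = E)
    (p q r s : ℝ) (h : p * s - q * r = 1) :
    mat (slEmbed E hE hE2 p q r s h) = slMatrix E p q r s := rfl

theorem hasDerivAt_slMatrix (E : Matrix (Fin 2) (Fin 2) ℝ) {p q r s : ℝ → ℝ}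
    {p' q' r' s' t₀ : ℝ} (hp : HasDerivAt p p' t₀) (hq : HasDerivAt q q' t₀)
    (hr : HasDerivAt r r' t₀) (hs : HasDerivAt s s' t₀) (i j : I4) :
    HasDerivAt (fun t => slMatrix E (p t) (q t) (r t) (s t) i j)
      (fromBlocks (p' • E) (q' • E) (r' • E) (s' • E) i j) t₀ := by
  rcases i with i | i <;> rcases j with j | j <;>
    simp only [slMatrix, fromBlocks_apply₁₁, fromBlocks_apply₁₂, fromBlocks_apply₂₁,
      fromBlocks_apply₂₂, Matrix.add_apply, Matrix.smul_apply, smul_eq_mul]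
  · exact ((hp.sub_const 1).mul_const _).const_add _
  · exact hq.mul_const _
  · exact hr.mul_const _
  · exact ((hs.sub_const 1).mul_const _).const_add _

section curves

variable (E : Matrix (Fin 2) (Fin 2) ℝ) (hE : Eᵀ = E) (hE2 : E * E = E)

/-- The one-parameter group in the Levi component with direction `E`. -/
def leviCurve (t : ℝ) : GSp4 :=
  slEmbed E hE hE2 (Real.exp t) 0 0 (Real.exp (-t)) (by rw [← Real.exp_add]; simp)

/-- The one-parameter group in `U` with direction `E`. -/
def unipCurve (t : ℝ) : GSp4 := slEmbed E hE hE2 1 t 0 1 (by ring)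

/-- The one-parameter group of rotations with direction `E`. -/
def rotCurve (t : ℝ) : GSp4 :=
  slEmbed E hE hE2 (Real.cos t) (Real.sin t) (-Real.sin t) (Real.cos t)
    (by linear_combination Real.cos_sq_add_sin_sq t)

theorem slMatrix_one : slMatrix E 1 0 0 1 = 1 := by
  simp [slMatrix]

theorem leviCurve_zero : leviCurve E hE hE2 0 = 1 := by
  apply mat_injective
  simp [leviCurve, mat_slEmbed, slMatrix_one, mat_one]

theorem unipCurve_zero : unipCurve E hE hE2 0 = 1 := by
  apply mat_injective
  simp [unipCurve, mat_slEmbed, slMatrix_one, mat_one]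

theorem rotCurve_zero : rotCurve E hE hE2 0 = 1 := by
  apply mat_injective
  simp [rotCurve, mat_slEmbed, slMatrix_one, mat_one]

theorem isUnitaryBlock_rotCurve (t : ℝ) : IsUnitaryBlock (rotCurve E hE hE2 t) := by
  refine ⟨?_, 1 + (Real.cos t - 1) • E, Real.sin t • E, by
    simp [rotCurve, mat_slEmbed, slMatrix]⟩
  change (slMatrix E _ _ _ _)ᵀ * slMatrix E _ _ _ _ = 1
  have h := Real.cos_sq_add_sin_sq t
  rw [← fromBlocks_one]
  simp only [slMatrix, fromBlocks_transpose, transpose_add, transpose_smul, transpose_one, hE,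
    fromBlocks_multiply]
  congr 1 <;>
  · simp only [Matrix.add_mul, Matrix.mul_add, Matrix.smul_mul, Matrix.mul_smul, hE2,
      Matrix.mul_one, Matrix.one_mul]
    ext i j
    simp only [Matrix.add_apply, Matrix.smul_apply, Matrix.zero_apply, smul_eq_mul]
    first | ring1 | linear_combination (E i j) * h

theorem hasDerivAt_leviCurve (t : ℝ) (i j : I4) :
    HasDerivAt (fun t => mat (leviCurve E hE hE2 t) i j)
      ((mat (leviCurve E hE hE2 t) * fromBlocks E 0 0 (-E)) i j) t := by
  have h := hasDerivAt_slMatrix E (Real.hasDerivAt_exp t) (hasDerivAt_const t (0 : ℝ))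
    (hasDerivAt_const t (0 : ℝ)) ((hasDerivAt_neg t).exp) i j
  convert h using 1
  congr 1
  simp only [leviCurve, mat_slEmbed, slMatrix, fromBlocks_multiply]
  congr 1 <;> simp [Matrix.add_mul, Matrix.sub_mul, hE2, sub_smul]

theorem hasDerivAt_unipCurve (i j : I4) :
    HasDerivAt (fun t => mat (unipCurve E hE hE2 t) i j) (fromBlocks 0 E 0 0 i j) 0 := by
  simpa [unipCurve, mat_slEmbed] using
    hasDerivAt_slMatrix E (hasDerivAt_const (0 : ℝ) (1 : ℝ)) (hasDerivAt_id (0 : ℝ))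
    (hasDerivAt_const (0 : ℝ) (0 : ℝ)) (hasDerivAt_const (0 : ℝ) (1 : ℝ)) i j

theorem hasDerivAt_rotCurve (i j : I4) :
    HasDerivAt (fun t => mat (rotCurve E hE hE2 t) i j) (fromBlocks 0 E (-E) 0 i j) 0 := by
  simpa [rotCurve, mat_slEmbed] using
    hasDerivAt_slMatrix E (Real.hasDerivAt_cos 0) (Real.hasDerivAt_sin 0)
    (Real.hasDerivAt_sin 0).neg (Real.hasDerivAt_cos 0) i j

end curves

/-! ### Equivariance and growth -/

/-- `f` transforms under `U` on the left by the character `θ`. -/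
def IsEquivariant (S : Matrix (Fin 2) (Fin 2) ℝ) (f : GSp4 → ℂ) : Prop :=
  ∀ (u : unip) (g : GSp4), f (u * g) = theta S u * f g

/-- `f` has polynomial growth, with an integral exponent. -/
def HasPolyGrowth (f : GSp4 → ℂ) : Prop :=
  ∃ (C : ℝ) (n : ℕ), ∀ g, ‖f g‖ ≤ C * (1 + groupNorm g) ^ n

theorem groupNorm_nonneg (g : GSp4) : 0 ≤ groupNorm g := Real.sqrt_nonneg _

theorem IsSlowlyIncreasing.hasPolyGrowth {f : GSp4 → ℂ} (hf : IsSlowlyIncreasing f) :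
    HasPolyGrowth f := by
  obtain ⟨α, β, hα, hβ, h⟩ := hf
  refine ⟨α, ⌈β⌉₊, fun g => (h g).trans ?_⟩
  have h0 := groupNorm_nonneg g
  gcongr
  calc groupNorm g ^ β ≤ (1 + groupNorm g) ^ β :=
        Real.rpow_le_rpow h0 (by linarith) hβ.le
    _ ≤ (1 + groupNorm g) ^ (⌈β⌉₊ : ℝ) :=
        Real.rpow_le_rpow_of_exponent_le (by linarith) (Nat.le_ceil β)
    _ = _ := Real.rpow_natCast _ _

theorem HasPolyGrowth.add {f f' : GSp4 → ℂ} (hf : HasPolyGrowth f) (hf' : HasPolyGrowth f') :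
    HasPolyGrowth (f + f') := by
  obtain ⟨C, n, h⟩ := hf
  obtain ⟨C', n', h'⟩ := hf'
  refine ⟨|C| + |C'|, n + n', fun g => ?_⟩
  have h1 : 1 ≤ 1 + groupNorm g := by linarith [groupNorm_nonneg g]
  calc ‖(f + f') g‖ ≤ ‖f g‖ + ‖f' g‖ := norm_add_le _ _
    _ ≤ C * (1 + groupNorm g) ^ n + C' * (1 + groupNorm g) ^ n' := add_le_add (h g) (h' g)
    _ ≤ |C| * (1 + groupNorm g) ^ (n + n') + |C'| * (1 + groupNorm g) ^ (n + n') := by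
        gcongr
        · exact le_abs_self C
        · exact Nat.le_add_right _ _
        · exact le_abs_self C'
        · exact Nat.le_add_left _ _
    _ = _ := by ring

theorem HasPolyGrowth.smul {f : GSp4 → ℂ} (c : ℂ) (hf : HasPolyGrowth f) :
    HasPolyGrowth (c • f) := by
  obtain ⟨C, n, h⟩ := hf
  refine ⟨‖c‖ * C, n, fun g => ?_⟩
  rw [Pi.smul_apply, norm_smul, mul_assoc]
  exact mul_le_mul_of_nonneg_left (h g) (norm_nonneg c)

theorem HasPolyGrowth.translate {f : GSp4 → ℂ} (hf : HasPolyGrowth f) {k : GSp4}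
    (hk : k ∈ maxCompact) : HasPolyGrowth fun g => f (g * k) := by
  obtain ⟨C, n, h⟩ := hf
  exact ⟨C, n, fun g => by
    simpa [groupNorm_mul_of_mem_maxCompact g hk] using h (g * k)⟩

/-! ### The finite-dimensional space attached to `B` -/

/-- The span of the translates of `B` under `K`. -/
def translateSpan (B : GSp4 → ℂ) : Submodule ℂ (GSp4 → ℂ) :=
  Submodule.span ℂ (Set.range fun (k : maxCompact) (g : GSp4) => B (g * k))

theorem translateSpan_translate {B f : GSp4 → ℂ} (hf : f ∈ translateSpan B) {k : GSp4}
    (hk : k ∈ maxCompact) : (fun g => f (g * k)) ∈ translateSpan B := by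
  have hle : translateSpan B ≤
      (translateSpan B).comap (LinearMap.funLeft ℂ ℂ fun g : GSp4 => g * k) := by
    rw [translateSpan, Submodule.span_le]
    rintro _ ⟨k', rfl⟩
    refine Submodule.subset_span ⟨⟨k, hk⟩ * k', ?_⟩
    funext g
    simp [LinearMap.funLeft_apply, mul_assoc]
  exact hle hf

/-- The equivariant functions of polynomial growth annihilated by `𝔭⁻` among the linear
combinations of the `K`-translates of `B`. -/
def holomorphicSpan (S : Matrix (Fin 2) (Fin 2) ℝ) (B : GSp4 → ℂ) :
    Submodule ℂ (GSp4 → ℂ) where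
  carrier := {f | f ∈ translateSpan B ∧ IsHolomorphic f ∧ IsEquivariant S f ∧ HasPolyGrowth f}
  zero_mem' := ⟨Submodule.zero_mem _, IsHolomorphic.zero, fun _ _ => by simp, 0, 0, by simp⟩
  add_mem' := by
    rintro f f' ⟨h1, h2, h3, h4⟩ ⟨h1', h2', h3', h4'⟩
    exact ⟨Submodule.add_mem _ h1 h1', h2.add h2', fun u g => by
      simp only [Pi.add_apply, h3 u g, h3' u g, mul_add], h4.add h4'⟩
  smul_mem' := by
    rintro c f ⟨h1, h2, h3, h4⟩
    exact ⟨Submodule.smul_mem _ c h1, h2.smul c, fun u g => by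
      simp only [Pi.smul_apply, h3 u g, smul_eq_mul, mul_left_comm], h4.smul c⟩

theorem holomorphicSpan_translate {S : Matrix (Fin 2) (Fin 2) ℝ} {B f : GSp4 → ℂ}
    (hf : f ∈ holomorphicSpan S B) {k : GSp4} (hk : IsUnitaryBlock k) :
    (fun g => f (g * k)) ∈ holomorphicSpan S B := by
  obtain ⟨h1, h2, h3, h4⟩ := hf
  exact ⟨translateSpan_translate h1 hk.1, h2.translate hk,
    fun u g => by simpa [mul_assoc] using h3 u (g * k), h4.translate hk.1⟩

theorem finiteDimensional_holomorphicSpan (S : Matrix (Fin 2) (Fin 2) ℝ) {B : GSp4 → ℂ}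
    (hB : IsKFinite B) : FiniteDimensional ℂ (holomorphicSpan S B) := by
  have : FiniteDimensional ℂ (translateSpan B) := hB
  exact Submodule.finiteDimensional_of_le (S₂ := translateSpan B) fun f hf => hf.1

/-- The derivative of `f` along the rotations with direction `E`. -/
def rotDeriv (E : Matrix (Fin 2) (Fin 2) ℝ) (hE : Eᵀ = E) (hE2 : E * E = E) (f : GSp4 → ℂ)
    (g : GSp4) : ℂ :=
  deriv (fun t => f (g * rotCurve E hE hE2 t)) 0

theorem HasDifferential.hasDerivAt_mul {f : GSp4 → ℂ} {D : Matrix I4 I4 ℝ →ₗ[ℝ] ℂ} {g : GSp4}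
    (hD : HasDifferential f D g) {γ : ℝ → GSp4} {M : Matrix I4 I4 ℝ} (h0 : γ 0 = 1)
    (hM : ∀ i j, HasDerivAt (fun t => mat (γ t) i j) (M i j) 0) :
    HasDerivAt (fun t => f (g * γ t)) (D (mat g * M)) 0 :=
  hD (fun t => g * γ t) 0 _ (by rw [h0, mul_one]) fun i j => by
    simpa [mat_one] using hasDerivAt_mul_entries g 1 hM i j

theorem HasDifferential.rotDeriv_eq {f : GSp4 → ℂ} {D : Matrix I4 I4 ℝ →ₗ[ℝ] ℂ} {g : GSp4}
    (hD : HasDifferential f D g) (E : Matrix (Fin 2) (Fin 2) ℝ) (hE : Eᵀ = E)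
    (hE2 : E * E = E) :
    rotDeriv E hE hE2 f g = D (mat g * fromBlocks 0 E (-E) 0) :=
  (hD.hasDerivAt_mul (rotCurve_zero E hE hE2) (hasDerivAt_rotCurve E hE hE2)).deriv

/-- The difference quotients lie in the space by stability under `U(2)` and converge pointwise. A
finite-dimensional subspace is closed for pointwise convergence, so the limit stays inside. -/
theorem rotDeriv_mem {S : Matrix (Fin 2) (Fin 2) ℝ} {B f : GSp4 → ℂ} (hB : IsKFinite B)
    (hf : f ∈ holomorphicSpan S B) (E : Matrix (Fin 2) (Fin 2) ℝ) (hE : Eᵀ = E)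
    (hE2 : E * E = E) : rotDeriv E hE hE2 f ∈ holomorphicSpan S B := by
  have := finiteDimensional_holomorphicSpan S hB
  have hcl : IsClosed (holomorphicSpan S B : Set (GSp4 → ℂ)) :=
    Submodule.closed_of_finiteDimensional _
  refine hcl.mem_of_tendsto (f := fun t : ℝ => ((t : ℂ)⁻¹) •
    ((fun g => f (g * rotCurve E hE hE2 t)) - f)) (b := 𝓝[≠] (0 : ℝ)) ?_ ?_
  · refine tendsto_pi_nhds.2 fun g => ?_
    obtain ⟨D, hD, -⟩ := hf.2.1 g
    have h := hD.hasDerivAt_mul (rotCurve_zero E hE hE2) (hasDerivAt_rotCurve E hE hE2)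
    rw [hD.rotDeriv_eq]
    have h' := h.tendsto_slope_zero
    simp only [zero_add, rotCurve_zero, mul_one] at h'
    refine h'.congr fun t => ?_
    rw [Pi.smul_apply, Pi.sub_apply, smul_eq_mul, Complex.real_smul, Complex.ofReal_inv]
  · exact Filter.Eventually.of_forall fun t => Submodule.smul_mem _ _ (Submodule.sub_mem _
      (holomorphicSpan_translate hf (isUnitaryBlock_rotCurve E hE hE2 t)) hf)

/-! ### The differential equation in the direction of the Levi component -/

theorem norm_exp_le {V : Type*} [NormedAddCommGroup V] [NormedSpace ℝ V] [CompleteSpace V]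
    (M : V →L[ℝ] V) : ‖NormedSpace.exp M‖ ≤ Real.exp ‖M‖ := by
  have h1 := NormedSpace.exp_series_hasSum_exp' (𝕂 := ℝ) M
  have h2 := NormedSpace.exp_series_hasSum_exp' (𝕂 := ℝ) ‖M‖
  rw [← Real.exp_eq_exp_ℝ] at h2
  refine h1.norm_le_of_bounded h2 fun n => ?_
  rw [norm_smul, Real.norm_of_nonneg (by positivity), smul_eq_mul]
  gcongr
  -- The term `n = 0` is separate because `V` may be trivial, so that only `‖1‖ ≤ 1` is available.
  rcases n with _ | n
  · have : ‖(1 : V →L[ℝ] V)‖ ≤ 1 := ContinuousLinearMap.norm_id_le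
    simpa using this
  · exact norm_pow_le' M n.succ_pos

/-- A solution of `Φ' = (a e^{2t} + M) Φ` with `a > 0` of at most exponential growth vanishes. -/
theorem eq_zero_of_hasDerivAt_of_le_exp {V : Type*} [NormedAddCommGroup V] [NormedSpace ℝ V]
    [CompleteSpace V] {Φ : ℝ → V} {a C D : ℝ} (ha : 0 < a) (M : V →L[ℝ] V)
    (hΦ : ∀ t, HasDerivAt Φ ((a * Real.exp (2 * t)) • Φ t + M (Φ t)) t)
    (hC : ∀ t, 0 ≤ t → ‖Φ t‖ ≤ C * Real.exp (D * t)) : Φ 0 = 0 := by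
  -- Integrating factors: `exp(-(a/2) e^{2t})` cancels the scalar term `a e^{2t}` and `exp(-tM)`
  -- cancels `M`, so `Ψ` is constant.
  set Ψ : ℝ → V := fun t => Real.exp (-(a / 2) * Real.exp (2 * t)) •
    NormedSpace.exp (t • (-M)) (Φ t) with hΨ
  have hder : ∀ t, HasDerivAt Ψ 0 t := by
    intro t
    have h1 : HasDerivAt (fun t => Real.exp (-(a / 2) * Real.exp (2 * t)))
        (Real.exp (-(a / 2) * Real.exp (2 * t)) * (-(a / 2) * (Real.exp (2 * t) * 2))) t := by
      simpa using (((hasDerivAt_id t).const_mul 2).exp.const_mul (-(a / 2))).exp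
    have h2 := (hasDerivAt_exp_smul_const (𝕂 := ℝ) (-M) t).clm_apply (hΦ t)
    refine (h1.smul h2).congr_deriv ?_
    simp only [mul_apply_eq_comp, _root_.neg_apply, map_add, map_neg,
      map_smul]
    module
  have hconst : ∀ t, Ψ t = Ψ 0 := fun t =>
    is_const_of_deriv_eq_zero (fun t => (hder t).differentiableAt) (fun t => (hder t).deriv) t 0
  have hC0 : 0 ≤ C := by
    have := (norm_nonneg _).trans (hC 0 le_rfl)
    simpa using this
  have hbound : ∀ t, 0 ≤ t → ‖Ψ 0‖ ≤ C * Real.exp (t * (-a * t + (‖M‖ + D))) := by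
    intro t ht
    have he : ‖NormedSpace.exp (t • (-M))‖ ≤ Real.exp (t * ‖M‖) := by
      refine (norm_exp_le (t • (-M))).trans (le_of_eq ?_)
      rw [norm_smul, norm_neg, Real.norm_of_nonneg ht]
    -- This weakens the doubly exponential decay to the Gaussian `exp(-a t²)`, which still beats
    -- `exp((‖M‖ + D) t)`.
    have hq : 2 * t ^ 2 ≤ Real.exp (2 * t) := by
      have := Real.quadratic_le_exp_of_nonneg (x := 2 * t) (by linarith)
      nlinarith
    rw [← hconst t, hΨ, norm_smul, Real.norm_of_nonneg (Real.exp_pos _).le]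
    calc Real.exp (-(a / 2) * Real.exp (2 * t)) * ‖NormedSpace.exp (t • (-M)) (Φ t)‖
        ≤ Real.exp (-(a / 2) * Real.exp (2 * t)) * (Real.exp (t * ‖M‖) *
          (C * Real.exp (D * t))) := by
          gcongr
          exact (ContinuousLinearMap.le_opNorm _ _).trans
            (mul_le_mul he (hC t ht) (norm_nonneg _) (Real.exp_pos _).le)
      _ ≤ Real.exp (-(a / 2) * (2 * t ^ 2)) * (Real.exp (t * ‖M‖) *
          (C * Real.exp (D * t))) := by
          gcongr ?_ * _
          refine Real.exp_le_exp.2 ?_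
          nlinarith
      _ = C * Real.exp (t * (-a * t + (‖M‖ + D))) := by
          have : t * (-a * t + (‖M‖ + D)) = -(a / 2) * (2 * t ^ 2) + t * ‖M‖ + D * t := by ring
          rw [this, Real.exp_add, Real.exp_add]
          ring
  have hlim : Filter.Tendsto (fun t : ℝ => C * Real.exp (t * (-a * t + (‖M‖ + D))))
      Filter.atTop (𝓝 (C * 0)) := by
    refine (Real.tendsto_exp_atBot.comp ?_).const_mul C
    refine Filter.tendsto_id.atTop_mul_atBot₀ ?_
    exact Filter.tendsto_atBot_add_const_right _ _
      (Filter.tendsto_id.const_mul_atTop_of_neg (neg_lt_zero.2 ha))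
  rw [mul_zero] at hlim
  have h0 : ‖Ψ 0‖ ≤ 0 := ge_of_tendsto hlim
    ((Filter.eventually_ge_atTop 0).mono hbound)
  have h1 : Ψ 0 = 0 := norm_le_zero_iff.1 h0
  simpa [hΨ, NormedSpace.exp_zero, (Real.exp_pos _).ne'] using h1

/-! ### Negative directions of the form, and conjugation of `U` by the Levi component -/

/-- `E` is the orthogonal projection onto the line of a vector `v` at which the indefinite form `c
S` is negative: `tr(S E)` is the value of `S` at `v` divided by `|v|²`. -/
theorem exists_projection {S : Matrix (Fin 2) (Fin 2) ℝ} (hS : S.IsSymm) (hdet : S.det < 0)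
    {c : ℝ} (hc : c ≠ 0) :
    ∃ E : Matrix (Fin 2) (Fin 2) ℝ, Eᵀ = E ∧ E * E = E ∧ c * (S * E).trace < 0 := by
  have h10 : S 1 0 = S 0 1 := hS.apply 0 1
  rw [det_fin_two, h10] at hdet
  have hw : ∃ x y : ℝ, x ^ 2 + y ^ 2 ≠ 0 ∧
      c * (S 0 0 * x ^ 2 + 2 * S 0 1 * x * y + S 1 1 * y ^ 2) < 0 := by
    by_cases ha : S 0 0 = 0
    · have hb : S 0 1 ≠ 0 := by
        intro hb
        simp [ha, hb] at hdet
      -- With `S 0 0 = 0` the form is affine in the first coordinate once the second is 1; this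
      -- choice makes its value `-c`.
      refine ⟨(-c - S 1 1) / (2 * S 0 1), 1, by positivity, ?_⟩
      have : c * (S 0 0 * ((-c - S 1 1) / (2 * S 0 1)) ^ 2
          + 2 * S 0 1 * ((-c - S 1 1) / (2 * S 0 1)) * 1 + S 1 1 * 1 ^ 2) = -(c ^ 2) := by
        rw [ha]; field_simp; ring
      rw [this]
      have : 0 < c ^ 2 := by positivity
      linarith
    · rcases lt_or_gt_of_ne (mul_ne_zero hc ha) with h | h
      · exact ⟨1, 0, by norm_num, by simpa using h⟩
      -- This vector is `S`-orthogonal to `(1, 0)`, and the form takes the value `S 0 0 * det S`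
      -- there.
      · refine ⟨-S 0 1, S 0 0, by positivity, ?_⟩
        have : c * (S 0 0 * (-S 0 1) ^ 2 + 2 * S 0 1 * (-S 0 1) * S 0 0 + S 1 1 * S 0 0 ^ 2)
          = (c * S 0 0) * (S 0 0 * S 1 1 - S 0 1 * S 0 1) := by ring
        rw [this]
        exact mul_neg_of_pos_of_neg h hdet
  obtain ⟨x, y, hn, hxy⟩ := hw
  have hn' : 0 < x ^ 2 + y ^ 2 := lt_of_le_of_ne (by positivity) hn.symm
  refine ⟨(x ^ 2 + y ^ 2)⁻¹ • !![x ^ 2, x * y; x * y, y ^ 2], ?_, ?_, ?_⟩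
  · ext i j
    fin_cases i <;> fin_cases j <;> simp
  · ext i j
    fin_cases i <;> fin_cases j <;> simp [Matrix.mul_apply] <;> field_simp
  · have : c * (S * ((x ^ 2 + y ^ 2)⁻¹ • !![x ^ 2, x * y; x * y, y ^ 2])).trace
        = (x ^ 2 + y ^ 2)⁻¹ *
          (c * (S 0 0 * x ^ 2 + 2 * S 0 1 * x * y + S 1 1 * y ^ 2)) := by
      simp [Matrix.trace, Matrix.mul_apply, h10]
      ring
    rw [this]
    exact mul_neg_of_pos_of_neg (inv_pos.2 hn') hxy

/-- The element `[1, X; 0, 1]` of `U(ℝ)`. -/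
def unipOf (X : Matrix (Fin 2) (Fin 2) ℝ) (hX : X.IsSymm) : unip :=
  ⟨ofMatrix (fromBlocks 1 X 0 1) 1 one_ne_zero (by
    simp [fromBlocks_transpose, J, fromBlocks_multiply, hX.eq]), X, hX, rfl⟩

theorem mat_unipOf (X : Matrix (Fin 2) (Fin 2) ℝ) (hX : X.IsSymm) :
    mat (unipOf X hX) = fromBlocks 1 X 0 1 := rfl

theorem theta_unipOf (S X : Matrix (Fin 2) (Fin 2) ℝ) (hX : X.IsSymm) :
    theta S (unipOf X hX) = Complex.exp (2 * Real.pi * Complex.I * ((S * X).trace : ℝ)) := by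
  rw [theta, mat_unipOf, toBlocks_fromBlocks₁₂]

/-- Conjugation by the Levi curve scales `E` by `e^{2s}`, and conjugation by `m` sends `X` to `c⁻¹ A
X ᵗA`. So `X` is `t e^{2s} c⁻¹ A E ᵗA`. -/
theorem mat_mul_leviCurve (S : Matrix (Fin 2) (Fin 2) ℝ) {E : Matrix (Fin 2) (Fin 2) ℝ}
    (hE : Eᵀ = E) (hE2 : E * E = E) {m : GSp4} {A : GL (Fin 2) ℝ} {c : ℝˣ}
    (hm : mat m = fromBlocks (A : Matrix (Fin 2) (Fin 2) ℝ) 0 0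
      ((c : ℝ) • ((A⁻¹ : GL (Fin 2) ℝ) : Matrix (Fin 2) (Fin 2) ℝ)ᵀ)) (s t : ℝ) :
    ∃ X : Matrix (Fin 2) (Fin 2) ℝ, ∃ hX : X.IsSymm,
      (S * X).trace = t * (Real.exp (2 * s) * ((c : ℝ)⁻¹ *
        ((A : Matrix (Fin 2) (Fin 2) ℝ)ᵀ * S * A * E).trace)) ∧
      m * leviCurve E hE hE2 s * unipCurve E hE hE2 t
        = unipOf X hX * (m * leviCurve E hE hE2 s) := by
  have hA : (A : Matrix (Fin 2) (Fin 2) ℝ)ᵀ * ((A⁻¹ : GL (Fin 2) ℝ) : Matrix (Fin 2) (Fin 2) ℝ)ᵀ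
      = 1 := by
    rw [← transpose_mul, Units.inv_mul, transpose_one]
  have hX : ((t * Real.exp (2 * s) * (c : ℝ)⁻¹) •
      ((A : Matrix (Fin 2) (Fin 2) ℝ) * E * (A : Matrix (Fin 2) (Fin 2) ℝ)ᵀ)).IsSymm := by
    simp only [IsSymm, transpose_smul, transpose_mul, transpose_transpose, hE, Matrix.mul_assoc]
  refine ⟨_, hX, ?_, ?_⟩
  · have h1 : (S * ((A : Matrix (Fin 2) (Fin 2) ℝ) * E * (A : Matrix (Fin 2) (Fin 2) ℝ)ᵀ)).trace
        = ((A : Matrix (Fin 2) (Fin 2) ℝ)ᵀ * S * A * E).trace := by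
      rw [← Matrix.mul_assoc, Matrix.trace_mul_comm]
      simp only [Matrix.mul_assoc]
    rw [Matrix.mul_smul, Matrix.trace_smul, h1, smul_eq_mul]
    ring
  · apply mat_injective
    have h1 : (1 + (Real.exp s - 1) • E) * E = Real.exp s • E := by
      simp only [Matrix.add_mul, Matrix.one_mul, Matrix.smul_mul, hE2]
      module
    have h2 : E * (1 + (Real.exp (-s) - 1) • E) = Real.exp (-s) • E := by
      simp only [Matrix.mul_add, Matrix.mul_one, Matrix.mul_smul, hE2]
      module
    have h3 : (A : Matrix (Fin 2) (Fin 2) ℝ) * E * (A : Matrix (Fin 2) (Fin 2) ℝ)ᵀ *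
        (((A⁻¹ : GL (Fin 2) ℝ) : Matrix (Fin 2) (Fin 2) ℝ)ᵀ * (1 + (Real.exp (-s) - 1) • E))
        = Real.exp (-s) • ((A : Matrix (Fin 2) (Fin 2) ℝ) * E) := by
      rw [← Matrix.mul_assoc, Matrix.mul_assoc _ _
        ((A⁻¹ : GL (Fin 2) ℝ) : Matrix (Fin 2) (Fin 2) ℝ)ᵀ, hA, Matrix.mul_one, Matrix.mul_assoc,
        h2, Matrix.mul_smul]
    have h4 : c * (t * Real.exp (2 * s) * (c : ℝ)⁻¹ * Real.exp (-s)) = t * Real.exp s := by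
      have : Real.exp s = Real.exp (2 * s) * Real.exp (-s) := by
        rw [← Real.exp_add]
        ring_nf
      rw [this]
      field_simp
    generalize ((A⁻¹ : GL (Fin 2) ℝ) : Matrix (Fin 2) (Fin 2) ℝ) = A' at hm h3
    simp only [mat_mul, hm, leviCurve, unipCurve, mat_slEmbed, slMatrix, mat_unipOf,
      fromBlocks_multiply]
    simp only [Matrix.mul_assoc] at h3
    congr 1 <;> simp [Matrix.mul_assoc, h1]
    rw [h3]
    simp only [smul_smul, h4]

/-! ### Growth along the Levi component -/

/-- The entries are combinations of `1`, `e^t`, `e^{-t}` with coefficients fixed by `m`, and the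
multiplier is constant along the curve. -/
theorem exists_groupNorm_le {E : Matrix (Fin 2) (Fin 2) ℝ} (hE : Eᵀ = E) (hE2 : E * E = E)
    (m : GSp4) :
    ∃ C : ℝ, ∀ t, 0 ≤ t → groupNorm (m * leviCurve E hE hE2 t) ≤ C * Real.exp t := by
  have hmult : ∀ t, mult (m * leviCurve E hE hE2 t) = mult m := fun t => by
    have : mult (leviCurve E hE hE2 t) = 1 := mult_eq_of
      (slMatrix_symplectic hE hE2 (by rw [← Real.exp_add]; simp))
    rw [mult_mul, this, mul_one]
  set a : Matrix I4 I4 ℝ := mat m * fromBlocks (1 - E) 0 0 (1 - E) with ha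
  set b : Matrix I4 I4 ℝ := mat m * fromBlocks E 0 0 0 with hb
  set c : Matrix I4 I4 ℝ := mat m * fromBlocks 0 0 0 E with hc
  have hmat : ∀ t, mat (m * leviCurve E hE hE2 t)
      = a + Real.exp t • b + Real.exp (-t) • c := fun t => by
    rw [ha, hb, hc, ← Matrix.mul_smul, ← Matrix.mul_smul, ← Matrix.mul_add, ← Matrix.mul_add,
      mat_mul]
    congr 1
    rw [fromBlocks_smul, fromBlocks_smul, fromBlocks_add, fromBlocks_add]
    simp only [leviCurve, mat_slEmbed, slMatrix]
    congr 1 <;> simp <;> module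
  have hentry : ∀ t, 0 ≤ t → ∀ i j, mat (m * leviCurve E hE hE2 t) i j ^ 2
      ≤ Real.exp t ^ 2 * (|a i j| + |b i j| + |c i j|) ^ 2 := fun t ht i j => by
    rw [← mul_pow, sq_le_sq, abs_of_nonneg (by positivity : 0 ≤ Real.exp t *
      (|a i j| + |b i j| + |c i j|)), hmat]
    simp only [Matrix.add_apply, Matrix.smul_apply, smul_eq_mul]
    have h1 : 1 ≤ Real.exp t := Real.one_le_exp ht
    have h2 : Real.exp (-t) ≤ Real.exp t := Real.exp_le_exp.2 (by linarith)
    calc |a i j + Real.exp t * b i j + Real.exp (-t) * c i j|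
        ≤ |a i j| + |Real.exp t * b i j| + |Real.exp (-t) * c i j| := abs_add_three _ _ _
      _ = 1 * |a i j| + Real.exp t * |b i j| + Real.exp (-t) * |c i j| := by
          rw [abs_mul, abs_mul, abs_of_pos (Real.exp_pos _), abs_of_pos (Real.exp_pos _), one_mul]
      _ ≤ Real.exp t * |a i j| + Real.exp t * |b i j| + Real.exp t * |c i j| := by gcongr
      _ = _ := by ring
  refine ⟨Real.sqrt ((mult m ^ 2)⁻¹ + ∑ i, ∑ j, (|a i j| + |b i j| + |c i j|) ^ 2),
    fun t ht => ?_⟩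
  rw [groupNorm, hmult, ← Real.sqrt_sq (Real.exp_pos t).le, ← Real.sqrt_mul' _ (sq_nonneg _)]
  refine Real.sqrt_le_sqrt ?_
  rw [add_mul, mul_comm (∑ i, _), Finset.mul_sum]
  refine add_le_add ?_ (Finset.sum_le_sum fun i _ => ?_)
  · refine le_mul_of_one_le_right (by positivity) (one_le_pow₀ (Real.one_le_exp ht))
  · rw [Finset.mul_sum]
    exact Finset.sum_le_sum fun j _ => hentry t ht i j

theorem HasPolyGrowth.exists_le_exp {f : GSp4 → ℂ} (hf : HasPolyGrowth f)
    {E : Matrix (Fin 2) (Fin 2) ℝ} (hE : Eᵀ = E) (hE2 : E * E = E) (m : GSp4) :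
    ∃ (C : ℝ) (n : ℕ), 0 ≤ C ∧
      ∀ t, 0 ≤ t → ‖f (m * leviCurve E hE hE2 t)‖ ≤ C * Real.exp (n * t) := by
  obtain ⟨C, n, h⟩ := hf
  obtain ⟨C', h'⟩ := exists_groupNorm_le hE hE2 m
  refine ⟨|C| * (1 + |C'|) ^ n, n, by positivity, fun t ht => ?_⟩
  have h1 : 1 ≤ Real.exp t := Real.one_le_exp ht
  have h2 : 1 + groupNorm (m * leviCurve E hE hE2 t) ≤ (1 + |C'|) * Real.exp t := by
    rw [add_mul, one_mul]
    exact add_le_add h1 ((h' t ht).trans (by gcongr; exact le_abs_self C'))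
  have h0 := groupNorm_nonneg (m * leviCurve E hE hE2 t)
  calc ‖f (m * leviCurve E hE hE2 t)‖
      ≤ C * (1 + groupNorm (m * leviCurve E hE hE2 t)) ^ n := h _
    _ ≤ |C| * ((1 + |C'|) * Real.exp t) ^ n := by
        gcongr
        exact le_abs_self C
    _ = _ := by rw [mul_pow, ← Real.exp_nat_mul, mul_assoc]

/-- The differential equation satisfied by holomorphic functions along the Levi component. -/
theorem hasDerivAt_leviCurve_of_mem {S : Matrix (Fin 2) (Fin 2) ℝ} {f : GSp4 → ℂ}
    (hhol : IsHolomorphic f) (heq : IsEquivariant S f)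
    {E : Matrix (Fin 2) (Fin 2) ℝ} (hE : Eᵀ = E) (hE2 : E * E = E) {m : GSp4}
    {A : GL (Fin 2) ℝ} {c : ℝˣ}
    (hm : mat m = fromBlocks (A : Matrix (Fin 2) (Fin 2) ℝ) 0 0
      ((c : ℝ) • ((A⁻¹ : GL (Fin 2) ℝ) : Matrix (Fin 2) (Fin 2) ℝ)ᵀ)) (s : ℝ) :
    HasDerivAt (fun t => f (m * leviCurve E hE hE2 t))
      (((-(4 * Real.pi * ((c : ℝ)⁻¹ * ((A : Matrix (Fin 2) (Fin 2) ℝ)ᵀ * S * A * E).trace)) *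
        Real.exp (2 * s) : ℝ) : ℂ) * f (m * leviCurve E hE hE2 s)
        - Complex.I * rotDeriv E hE hE2 f (m * leviCurve E hE hE2 s)) s := by
  set q : ℝ := (c : ℝ)⁻¹ * ((A : Matrix (Fin 2) (Fin 2) ℝ)ᵀ * S * A * E).trace with hq
  set g := m * leviCurve E hE hE2 s with hg
  obtain ⟨D, hD, hDE⟩ := hhol g
  have h1 : HasDerivAt (fun t => f (m * leviCurve E hE hE2 t))
      (D (mat g * fromBlocks E 0 0 (-E))) s := by
    refine hD (fun t => m * leviCurve E hE hE2 t) s _ rfl fun i j => ?_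
    have := hasDerivAt_mul_entries m 1 (hasDerivAt_leviCurve E hE hE2 s) i j
    simpa [mat_one, hg, mat_mul, Matrix.mul_assoc] using this
  have h2 := hD.hasDerivAt_mul (unipCurve_zero E hE hE2) (hasDerivAt_unipCurve E hE hE2)
  have h3 : HasDerivAt (fun t => f (g * unipCurve E hE hE2 t))
      (2 * Real.pi * Complex.I * (Real.exp (2 * s) * q : ℝ) * f g) 0 := by
    have he : ∀ t, f (g * unipCurve E hE hE2 t)
        = Complex.exp (2 * Real.pi * Complex.I * ((t : ℂ) * (Real.exp (2 * s) * q : ℝ))) * f g := by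
      intro t
      obtain ⟨X, hX, htr, hgX⟩ := mat_mul_leviCurve S hE hE2 hm s t
      rw [hgX, heq, theta_unipOf, htr, ← hq, Complex.ofReal_mul t]
    simp only [he]
    have hid : HasDerivAt (fun t : ℝ => (t : ℂ)) 1 0 := Complex.ofRealCLM.hasDerivAt
    have := (((hid.mul_const ((Real.exp (2 * s) * q : ℝ) : ℂ)).const_mul
      (2 * Real.pi * Complex.I)).cexp).mul_const (f g)
    simpa using this
  -- The unipotent derivative, computed once by the differential and once by equivariance.
  have h4 := h2.unique h3
  have h5 := hD.rotDeriv_eq E hE hE2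
  have h6 := hDE (E.map Complex.ofReal) (by
    ext i j
    simpa using congrFun (congrFun hE i) j)
  have hre : (lowering (E.map Complex.ofReal)).map Complex.re = fromBlocks E 0 0 (-E) := by
    ext i j
    rcases i with i | i <;> rcases j with j | j <;> simp [lowering]
  have him : (lowering (E.map Complex.ofReal)).map Complex.im
      = fromBlocks 0 E (-E) 0 - (2 : ℝ) • fromBlocks 0 E 0 0 := by
    ext i j
    rcases i with i | i <;> rcases j with j | j <;> simp [lowering]
    ring
  -- The vanishing on `lowering E` now expresses the Levi derivative through the unipotent and
  -- rotation derivatives.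
  simp only [complexDiff, LinearMap.coe_mk, AddHom.coe_mk, hre, him, Matrix.mul_sub,
    Matrix.mul_smul, map_sub, map_smul, h4, ← h5, Complex.real_smul] at h6
  refine h1.congr_deriv ?_
  push_cast at h6 ⊢
  linear_combination h6 + 4 * Real.pi * Complex.exp (2 * s) * q * f g * Complex.I_sq

/-- Functions in `holomorphicSpan` vanish on the Levi component. -/
theorem eq_zero_of_mem_levi {S : Matrix (Fin 2) (Fin 2) ℝ} (hS : S.IsSymm) (hdet : S.det < 0)
    {B f : GSp4 → ℂ} (hB : IsKFinite B) (hf : f ∈ holomorphicSpan S B) {m : GSp4}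
    (hm : m ∈ levi) : f m = 0 := by
  obtain ⟨A, c, hm⟩ := hm
  have hS' : ((A : Matrix (Fin 2) (Fin 2) ℝ)ᵀ * S * A).IsSymm := by
    simp only [IsSymm, transpose_mul, transpose_transpose, hS.eq, Matrix.mul_assoc]
  have hA : (A : Matrix (Fin 2) (Fin 2) ℝ).det ≠ 0 :=
    ((Matrix.isUnit_iff_isUnit_det _).1 A.isUnit).ne_zero
  have hdet' : ((A : Matrix (Fin 2) (Fin 2) ℝ)ᵀ * S * A).det < 0 := by
    rw [det_mul, det_mul, det_transpose]
    have : 0 < (A : Matrix (Fin 2) (Fin 2) ℝ).det ^ 2 := by positivity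
    nlinarith
  -- Congruence by `A` keeps the form indefinite, so a direction with `q < 0` exists whatever the
  -- sign of `c`.
  obtain ⟨E, hE, hE2, hneg⟩ := exists_projection hS' hdet' (inv_ne_zero c.ne_zero)
  set q := (c : ℝ)⁻¹ * ((A : Matrix (Fin 2) (Fin 2) ℝ)ᵀ * S * A * E).trace with hq
  have := finiteDimensional_holomorphicSpan S hB
  set b := Module.finBasis ℂ (holomorphicSpan S B)
  -- `N` expresses `rotDeriv` on the basis. Its entries do not depend on the point of the group, so
  -- the system along the curve has the constant matrix `-iN`.
  set N : Matrix (Fin (Module.finrank ℂ (holomorphicSpan S B)))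
      (Fin (Module.finrank ℂ (holomorphicSpan S B))) ℂ := Matrix.of fun i j =>
    b.repr ⟨_, rotDeriv_mem hB (b i).2 E hE hE2⟩ j with hN
  have hexpand : ∀ (φ : holomorphicSpan S B) (g : GSp4),
      (φ : GSp4 → ℂ) g = ∑ j, b.repr φ j * (b j : GSp4 → ℂ) g := fun φ g => by
    conv_lhs => rw [← b.sum_repr φ]
    simp only [Submodule.coe_sum, Finset.sum_apply, Submodule.coe_smul, Pi.smul_apply,
      smul_eq_mul]
  set Φ : ℝ → Fin (Module.finrank ℂ (holomorphicSpan S B)) → ℂ :=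
    fun t i => (b i : GSp4 → ℂ) (m * leviCurve E hE hE2 t) with hΦ
  set M := ((-Complex.I) • N).mulVecLin.toContinuousLinearMap.restrictScalars ℝ with hM
  choose C n hC0 hC using fun i => (b i).2.2.2.2.exists_le_exp hE hE2 m
  have hzero : Φ 0 = 0 := by
    -- Summing the constants and the exponents over the basis gives one bound for all components of
    -- `Φ`.
    refine eq_zero_of_hasDerivAt_of_le_exp (a := -(4 * Real.pi * q)) (C := ∑ i, C i)
      (D := (∑ i, n i : ℕ)) ?_ M ?_ ?_
    · nlinarith [Real.pi_pos]
    · intro t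
      refine hasDerivAt_pi.2 fun i => ?_
      refine (hasDerivAt_leviCurve_of_mem (b i).2.2.1 (b i).2.2.2.1 hE hE2 hm t).congr_deriv ?_
      have h1 := hexpand ⟨_, rotDeriv_mem hB (b i).2 E hE hE2⟩ (m * leviCurve E hE hE2 t)
      simp only at h1
      rw [h1, Pi.add_apply, Pi.smul_apply, Complex.real_smul, ← hq, sub_eq_add_neg]
      congr 1
      simp [hM, Matrix.mulVec, dotProduct, hN, hΦ, Finset.mul_sum, mul_assoc]
    · intro t ht
      have hsum : 0 ≤ ∑ i, C i := Finset.sum_nonneg fun i _ => hC0 i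
      refine (pi_norm_le_iff_of_nonneg (by positivity)).2 fun i => (hC i t ht).trans ?_
      gcongr
      · exact Finset.single_le_sum (fun i _ => hC0 i) (Finset.mem_univ i)
      · exact Finset.single_le_sum (fun i _ => Nat.zero_le (n i)) (Finset.mem_univ i)
  have hm0 := hexpand ⟨f, hf⟩ m
  refine hm0.trans (Finset.sum_eq_zero fun i _ => ?_)
  have := congrFun hzero i
  simp only [hΦ, leviCurve_zero, mul_one, Pi.zero_apply] at this
  rw [this, mul_zero]

/-! ### The Iwasawa decomposition -/

/-- `-J ᵗg J` is a left inverse of `μ⁻¹ g`, hence also a right inverse. The resulting relations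
between block rows are what the decompositions below use. -/
theorem mult_spec_transpose (g : GSp4) :
    mat g * J (Fin 2) ℝ * (mat g)ᵀ = mult g • J (Fin 2) ℝ := by
  have hμ := mult_ne_zero g
  have h1 : (-J (Fin 2) ℝ * (mat g)ᵀ * J (Fin 2) ℝ) * ((mult g)⁻¹ • mat g) = 1 := by
    rw [Matrix.mul_smul, Matrix.mul_assoc, Matrix.mul_assoc, ← Matrix.mul_assoc (mat g)ᵀ,
      mult_spec, Matrix.mul_smul, smul_smul, inv_mul_cancel₀ hμ, one_smul, neg_J_mul_J]
  have h2 := mul_eq_one_comm.1 h1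
  calc mat g * J (Fin 2) ℝ * (mat g)ᵀ
      = mult g • (((mult g)⁻¹ • mat g) * (-J (Fin 2) ℝ * (mat g)ᵀ * J (Fin 2) ℝ))
          * J (Fin 2) ℝ := by
        rw [Matrix.smul_mul, Matrix.smul_mul, Matrix.smul_mul, smul_smul, mul_inv_cancel₀ hμ, one_smul]
        simp only [Matrix.mul_assoc, J_squared, Matrix.mul_neg, Matrix.neg_mul, Matrix.mul_one,
          neg_neg]
    _ = _ := by rw [h2, Matrix.smul_mul, Matrix.one_mul]

open scoped MatrixOrder Matrix.Norms.L2Operator in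
-- No triangular shape is asked of `R`: the decomposition below is relative to the Siegel parabolic,
-- whose Levi component contains all of `GL(2)`.
theorem exists_mul_transpose_eq {P : Matrix (Fin 2) (Fin 2) ℝ} (hP : P.PosSemidef) :
    ∃ R : Matrix (Fin 2) (Fin 2) ℝ, R * Rᵀ = P := by
  obtain ⟨B, hB⟩ := CStarAlgebra.nonneg_iff_eq_star_mul_self.mp hP.nonneg
  refine ⟨Bᵀ, ?_⟩
  rw [hB, transpose_transpose, star_eq_conjTranspose, conjTranspose_eq_transpose_of_trivial]

/-- A matrix in the Siegel parabolic subgroup is a product of elements of `U` and `L`. -/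
theorem exists_unip_mul_levi {h : GSp4} {A B D : Matrix (Fin 2) (Fin 2) ℝ}
    (hh : mat h = fromBlocks A B 0 D) : ∃ u ∈ unip, ∃ m ∈ levi, h = u * m := by
  have hμ := mult_ne_zero h
  have h1 := mult_spec_transpose h
  rw [hh, J, fromBlocks_transpose, fromBlocks_multiply, fromBlocks_multiply, fromBlocks_smul,
    fromBlocks_inj] at h1
  obtain ⟨h11, h12, -, -⟩ := h1
  simp only [Matrix.mul_zero, Matrix.mul_one, zero_add, Matrix.mul_neg, add_zero,
    Matrix.neg_mul, transpose_zero, smul_zero, smul_neg, neg_inj] at h11 h12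
  have hBA : B * Aᵀ = A * Bᵀ := by
    rwa [← sub_eq_add_neg, sub_eq_zero] at h11
  set μ := mult h
  have hAD : A * (μ⁻¹ • Dᵀ) = 1 := by
    rw [Matrix.mul_smul, h12, smul_smul, inv_mul_cancel₀ hμ, one_smul]
  have hDA : Aᵀ * (μ⁻¹ • D) = 1 := by
    have := congrArg transpose (mul_eq_one_comm.1 hAD)
    simpa using this
  have hX : (μ⁻¹ • (B * Aᵀ)).IsSymm := by
    rw [IsSymm, transpose_smul, transpose_mul, transpose_transpose, hBA]
  have hAD' : Aᵀ * D = μ • 1 := by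
    rw [← hDA, Matrix.mul_smul, smul_smul, mul_inv_cancel₀ hμ, one_smul]
  have hDA' : Dᵀ * A = μ • 1 := by
    have := congrArg transpose hAD'
    simpa using this
  -- The relation `ᵗA D = μ` gives `D⁻¹ = μ⁻¹ ᵗA`, so the unipotent part `B D⁻¹` is `μ⁻¹ B ᵗA`, and
  -- `c = μ`.
  refine ⟨ofMatrix (fromBlocks 1 (μ⁻¹ • (B * Aᵀ)) 0 1) 1 one_ne_zero ?_, ⟨_, hX, rfl⟩,
    ofMatrix (fromBlocks A 0 0 D) μ hμ ?_,
    ⟨⟨A, μ⁻¹ • Dᵀ, hAD, mul_eq_one_comm.1 hAD⟩, Units.mk0 μ hμ, ?_⟩, ?_⟩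
  · simp [fromBlocks_transpose, J, fromBlocks_multiply, hX.eq]
  · simp [fromBlocks_transpose, J, fromBlocks_multiply, fromBlocks_smul, hAD', hDA']
  · simp [smul_smul, hμ]
  · apply mat_injective
    rw [mat_mul, mat_ofMatrix, mat_ofMatrix, hh, fromBlocks_multiply]
    simp [Matrix.mul_assoc, hAD', smul_smul, hμ]

/-- With `(C, D)` the lower block row of `g` and `R ᵗR = C ᵗC + D ᵗD`, the row `R⁻¹ (C, D)` is
orthonormal and is the lower row of some `k` in `U(2)`. Then `g k⁻¹` has zero lower left block. -/
theorem exists_iwasawa (g : GSp4) :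
    ∃ u ∈ unip, ∃ m ∈ levi, ∃ k, IsUnitaryBlock k ∧ g = u * m * k := by
  set C := (mat g).toBlocks₂₁
  set D := (mat g).toBlocks₂₂
  have hg : mat g = fromBlocks (mat g).toBlocks₁₁ (mat g).toBlocks₁₂ C D :=
    (fromBlocks_toBlocks _).symm
  have hCD : D * Cᵀ = C * Dᵀ := by
    have h1 := mult_spec_transpose g
    rw [hg, J, fromBlocks_transpose, fromBlocks_multiply, fromBlocks_multiply, fromBlocks_smul,
      fromBlocks_inj] at h1
    have h22 := h1.2.2.2
    simp only [Matrix.mul_zero, Matrix.mul_one, zero_add, Matrix.mul_neg, add_zero,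
      Matrix.neg_mul, smul_zero] at h22
    rwa [← sub_eq_add_neg, sub_eq_zero] at h22
  have hP : (C * Cᵀ + D * Dᵀ).PosSemidef := by
    have h1 := posSemidef_self_mul_conjTranspose C
    have h2 := posSemidef_self_mul_conjTranspose D
    rw [conjTranspose_eq_transpose_of_trivial] at h1 h2
    exact h1.add h2
  obtain ⟨R, hR⟩ := exists_mul_transpose_eq hP
  have hinv : ∃ X Y, C * X + D * Y = 1 := by
    have h1 := mat_mul_inv g
    rw [hg, ← fromBlocks_toBlocks (mat g⁻¹), fromBlocks_multiply, ← fromBlocks_one,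
      fromBlocks_inj] at h1
    exact ⟨_, _, h1.2.2.2⟩
  -- A row vector killed by `R` is killed by `C` and `D`, since the sum of squares vanishes; this
  -- contradicts the invertibility of `g`.
  have hRdet : R.det ≠ 0 := by
    intro h0
    obtain ⟨v, hv, hvR⟩ := Matrix.exists_vecMul_eq_zero_iff.2 h0
    have h1 : v ᵥ* C ⬝ᵥ v ᵥ* C + v ᵥ* D ⬝ᵥ v ᵥ* D = 0 := by
      have h2 : v ᵥ* (C * Cᵀ + D * Dᵀ) ⬝ᵥ v = 0 := by
        rw [← hR, ← Matrix.vecMul_vecMul, hvR, zero_vecMul, zero_dotProduct]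
      have h3 : ∀ M : Matrix (Fin 2) (Fin 2) ℝ,
          v ᵥ* (M * Mᵀ) ⬝ᵥ v = v ᵥ* M ⬝ᵥ v ᵥ* M := fun M => by
        rw [← Matrix.vecMul_vecMul, Matrix.vecMul_transpose, dotProduct_comm, dotProduct_mulVec]
      rwa [Matrix.vecMul_add, add_dotProduct, h3, h3] at h2
    have hn : ∀ w : Fin 2 → ℝ, 0 ≤ w ⬝ᵥ w := fun w =>
      Finset.sum_nonneg fun i _ => mul_self_nonneg _
    have hvC : v ᵥ* C = 0 := dotProduct_self_eq_zero.1 (by linarith [hn (v ᵥ* C), hn (v ᵥ* D)])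
    have hvD : v ᵥ* D = 0 := dotProduct_self_eq_zero.1 (by linarith [hn (v ᵥ* C), hn (v ᵥ* D)])
    obtain ⟨X, Y, hXY⟩ := hinv
    apply hv
    rw [← Matrix.vecMul_one v, ← hXY, Matrix.vecMul_add, ← Matrix.vecMul_vecMul,
      ← Matrix.vecMul_vecMul, hvC, hvD, zero_vecMul, zero_vecMul, add_zero]
  have hRu : IsUnit R.det := isUnit_iff_ne_zero.2 hRdet
  have hR1 : R⁻¹ * R = 1 := Matrix.nonsing_inv_mul _ hRu
  have hR3 : Rᵀ * R⁻¹ᵀ = 1 := by rw [← transpose_mul, hR1, transpose_one]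
  set x := R⁻¹ * D with hx
  set y := -(R⁻¹ * C) with hy
  have hxy1 : x * xᵀ + y * yᵀ = 1 := by
    calc x * xᵀ + y * yᵀ = R⁻¹ * (C * Cᵀ + D * Dᵀ) * R⁻¹ᵀ := by
          simp only [hx, hy, transpose_neg, transpose_mul, Matrix.neg_mul, Matrix.mul_neg, neg_neg,
            Matrix.mul_add, Matrix.add_mul, Matrix.mul_assoc]
          rw [add_comm]
      _ = (R⁻¹ * R) * (Rᵀ * R⁻¹ᵀ) := by rw [← hR]; simp only [Matrix.mul_assoc]
      _ = 1 := by rw [hR1, hR3, Matrix.one_mul]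
  have hxy2 : y * xᵀ = x * yᵀ := by
    calc y * xᵀ = -(R⁻¹ * (C * Dᵀ) * R⁻¹ᵀ) := by
          simp only [hx, hy, transpose_mul, Matrix.neg_mul, Matrix.mul_assoc]
      _ = x * yᵀ := by
          rw [← hCD]
          simp only [hx, hy, transpose_mul, transpose_neg, Matrix.mul_neg, Matrix.mul_assoc]
  set k : Matrix I4 I4 ℝ := fromBlocks x y (-y) x with hk
  have hkk : k * kᵀ = 1 := by
    rw [hk, fromBlocks_transpose, fromBlocks_multiply, ← fromBlocks_one]
    congr 1
    · simp [hxy2]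
    · simp [hxy2]
    · simpa [add_comm] using hxy1
  have hkk' : kᵀ * k = 1 := mul_eq_one_comm.1 hkk
  have hkJ : J (Fin 2) ℝ * k = k * J (Fin 2) ℝ := by
    simp [hk, J, fromBlocks_multiply]
  set K : GSp4 := ofMatrix k 1 one_ne_zero (by
    rw [Matrix.mul_assoc, hkJ, ← Matrix.mul_assoc, hkk', Matrix.one_mul, one_smul])
  have hKinv : mat K⁻¹ = kᵀ := by
    calc mat K⁻¹ = mat K⁻¹ * (k * kᵀ) := by rw [hkk, Matrix.mul_one]
      _ = mat K⁻¹ * mat K * kᵀ := by rw [Matrix.mul_assoc]; rfl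
      _ = kᵀ := by rw [mat_inv_mul, Matrix.one_mul]
  -- The lower left block of `g k⁻¹` is `(C ᵗD - D ᵗC) ᵗR⁻¹`, which vanishes by `hCD`.
  have h21 : C * xᵀ + D * yᵀ = 0 := by
    simp only [hx, hy, transpose_mul, transpose_neg, Matrix.mul_neg, ← Matrix.mul_assoc, hCD,
      add_neg_cancel]
  have h : mat (g * K⁻¹) = fromBlocks ((mat g).toBlocks₁₁ * xᵀ + (mat g).toBlocks₁₂ * yᵀ)
      ((mat g).toBlocks₁₁ * (-y)ᵀ + (mat g).toBlocks₁₂ * xᵀ) 0 (C * (-y)ᵀ + D * xᵀ) := by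
    rw [← h21, ← fromBlocks_multiply, ← hg, mat_mul, hKinv, hk, fromBlocks_transpose]
  obtain ⟨u, hu, m, hm, hum⟩ := exists_unip_mul_levi h
  exact ⟨u, hu, m, hm, K, ⟨hkk', x, y, rfl⟩, by rw [← hum, inv_mul_cancel_right]⟩

/-! ### Vanishing -/

variable {S : Matrix (Fin 2) (Fin 2) ℝ} {Λ : torus₀ S →ₜ* ℂˣ} {l l' : ℤ}

theorem IsBesselFunction.isEquivariant {B : GSp4 → ℂ} (hB : IsBesselFunction S Λ l l' B) :
    IsEquivariant S B := fun u g => by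
  simpa using hB.transform 1 u g

theorem IsBesselFunction.mem_holomorphicSpan {B : GSp4 → ℂ}
    (hB : IsBesselFunction S Λ l l' B) : B ∈ holomorphicSpan S B :=
  ⟨Submodule.subset_span ⟨1, by simp⟩,
    isHolomorphic_of_act_eq_zero hB.smooth hB.act_Xminus hB.act_P1minus hB.act_P0minus,
    hB.isEquivariant, hB.slowlyIncreasing.hasPolyGrowth⟩

/-- Bessel functions for a split `θ` vanish. Only the equivariance under `U`, the growth, the
`K`-finiteness and the annihilation by `𝔭⁻` are needed: since `S` is indefinite, such a function
grows exponentially in some direction of the Levi component (the Koecher principle). -/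
theorem IsBesselFunction.eq_zero {B : GSp4 → ℂ} (hB : IsBesselFunction S Λ l l' B)
    (hS : S.IsSymm) (hdet : S.det < 0) : B = 0 := by
  funext g
  obtain ⟨u, hu, m, hm, k, hk, rfl⟩ := exists_iwasawa g
  have h : B (m * k) = 0 := eq_zero_of_mem_levi hS hdet hB.kFinite
    (holomorphicSpan_translate hB.mem_holomorphicSpan hk) hm
  have hu' := hB.isEquivariant ⟨u, hu⟩ (m * k)
  rw [h, mul_zero] at hu'
  rw [mul_assoc]
  exact hu'

theorem isBesselFunction_zero (S : Matrix (Fin 2) (Fin 2) ℝ) (Λ : torus₀ S →ₜ* ℂˣ) (l l' : ℤ) :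
    IsBesselFunction S Λ l l' 0 where
  smooth g := ⟨0, contDiff_const, by simp⟩
  kFinite := by
    refine FiniteDimensional.span_of_finite ℂ ((Set.finite_singleton (0 : GSp4 → ℂ)).subset ?_)
    rintro _ ⟨k, rfl⟩
    rfl
  transform t u g := by simp
  slowlyIncreasing := ⟨1, 1, one_pos, one_pos, fun g => by
    simpa using groupNorm_nonneg g⟩
  weight_Z g := by simp [act, realAct]
  weight_Z' g := by simp [act, realAct]
  act_Nplus g := by simp [act, realAct]
  act_Xminus g := by simp [act, realAct]
  act_P1minus g := by simp [act, realAct]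
  act_P0minus g := by simp [act, realAct]

end

end SplitBessel

theorem mainTheorem3 (S : Matrix (Fin 2) (Fin 2) ℝ) (hS : S.IsSymm) (hdet : S.det < 0)
    (l l' : ℤ) (hl' : 0 < l') (hll' : l' ≤ l) (Λ : SplitBessel.torus₀ S →ₜ* ℂˣ) :
    SplitBessel.besselSpace S Λ l l' = {0} :=
  Set.eq_singleton_iff_unique_mem.2
    ⟨SplitBessel.isBesselFunction_zero S Λ l l', fun _ hB => hB.eq_zero hS hdet⟩
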